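/- Let $p$ be a prime, let $|\cdot|$ be the absolute value of $\mathbb C_p$ with $|p|=1/p$, and put $\rho=p^{-1/(p-1)}$ and $\Lambda=\{\lambda\in\mathbb C_p:|\lambda-1|<1\}$. Fix $\hat r\in|\mathbb C_p^*|$ with $\hat r>1$, let $B=\{z\in\mathbb C_p:|z|\le\hat r\}$, and let $Q(z)=\sum_{i\ge 0}a_iz^i$ be a power series over $\mathbb C_p$ that converges on $B$ (that is, $|a_i|\hat r^i\to0$) and satisfies $\|Q\|=\sup_i|a_i|\hat r^i<\rho$. For $\lambda\in\Lambda$ let $$P_\lambda(z)=\frac{\lambda}{p}z^p+\Bigl(1-\frac{\lambda}{p}\Bigr)z^{p+1},\qquad Q^*_\lambda=P_\lambda+Q .$$ Then for every $\lambda\in\Lambda$ the map $Q^*_\lambda$ has exactly one fixed point $h(\lambda)$ with $|h(\lambda)-1|\le|Q(1)|/p$, and, with $A_\lambda(z)=z+h(\lambda)-1$ and $Q_\lambda=A_\lambda^{-1}\circ Q^*_\lambda\circ A_\lambda$, the point $1$ is a repelling fixed point of $Q_\lambda$ (that is, $Q_\lambda(1)=1$ and $|Q_\lambda'(1)|>1$).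 Moreover, the set of all $\lambda\in\Lambda$ with the following property is dense in $\Lambda$: there is a disc $D$ (an open or closed ball of $\mathbb C_p$ with radius in $|\mathbb C_p^*|$) contained in the filled Julia set $K(Q_\lambda,B)=\{z\in B: Q_\lambda^n(z)\in B\text{ for all }n\ge 0\}$ that is wandering (that is, $Q_\lambda^n(D)\cap Q_\lambda^m(D)=\emptyset$ whenever $n\ne m$) and is not attracted to an attracting cycle: no point of $D$ has an orbit under $Q_\lambda$ converging to a cycle in $B$ of some period $k\ge1$ whose points $w$ satisfy $|(Q_\lambda^k)'(w)|<1$. -/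

import Mathlib

open Filter Topology Metric

noncomputable section

namespace WanderingDisc

/-! ### Dynamics of a map restricted to a set -/

section Dynamics

variable {K : Type*} [NontriviallyNormedField K]

/-- A disc: an open or closed ball whose radius is a nonzero value `‖c‖` of the norm. -/
def IsDisc (D : Set K) : Prop :=
  ∃ x c : K, c ≠ 0 ∧ (D = ball x ‖c‖ ∨ D = closedBall x ‖c‖)

/-- The filled Julia set `K(f, U)`: the points of `U` whose whole forward orbit stays in `U`. -/
def filledJulia (f : K → K) (U : Set K) : Set K :=
  {z | ∀ n : ℕ, f^[n] z ∈ U}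

/-- `E ⊆ U` is a wandering set of `(f, U)`: its iterates `f^n(E)` are pairwise disjoint. -/
def IsWanderingSet (f : K → K) (U E : Set K) : Prop :=
  E ⊆ U ∧ ∀ n m : ℕ, ((f^[n] '' E) ∩ (f^[m] '' E)).Nonempty → n = m

/-- `z` is a repelling fixed point of `f`. If `f` is not differentiable at `z` then
`deriv f z = 0`, so the condition includes differentiability. -/
def IsRepellingFixedPoint (f : K → K) (z : K) : Prop :=
  f z = z ∧ 1 < ‖deriv f z‖

/-- `w` lies on an attracting cycle of `(f, U)`: its orbit stays in `U`, `f^k(w) = w` for the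
positive integer `k`, and `w` is an attracting fixed point of `f^k`. -/
def IsAttractingPeriodicPoint (f : K → K) (U : Set K) (k : ℕ) (w : K) : Prop :=
  0 < k ∧ w ∈ filledJulia f U ∧ f^[k] w = w ∧
    DifferentiableAt K f^[k] w ∧ ‖deriv f^[k] w‖ < 1

/-- The point `z` is attracted to an attracting cycle of `(f, U)`: for some point `w` of an
attracting cycle of period `k`, the sequence `f^{kn}(z)` converges to `w`. -/
def IsAttractedToAttractingCycle (f : K → K) (U : Set K) (z : K) : Prop :=
  ∃ (k : ℕ) (w : K), IsAttractingPeriodicPoint f U k w ∧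
    Tendsto (fun n : ℕ => f^[k * n] z) atTop (𝓝 w)

end Dynamics

/-! ### The families of maps -/

section Family

variable (p : ℕ) [Fact p.Prime]

/-- The parameter disc `Λ = {λ : |λ - 1| < 1}`. -/
def paramDisc : Set ℂ_[p] := ball 1 1

/-- The real number `ρ = p^{-1/(p-1)}`, the positive solution of `p ρ^p = ρ`. -/
def rho : ℝ := (p : ℝ) ^ (-(1 / ((p : ℝ) - 1)))

variable {p}

/-- The value at `z` of a power series. -/
def evalSeries (f : PowerSeries ℂ_[p]) (z : ℂ_[p]) : ℂ_[p] :=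
  ∑' n : ℕ, PowerSeries.coeff n f * z ^ n

/-- `P_λ(z) = (λ/p) z^p + (1 - λ/p) z^{p+1}`. -/
def benedettoMap (lam z : ℂ_[p]) : ℂ_[p] :=
  lam / (p : ℂ_[p]) * z ^ p + (1 - lam / (p : ℂ_[p])) * z ^ (p + 1)

/-- `Q*_λ = P_λ + Q`. -/
def perturbedMap (Q : PowerSeries ℂ_[p]) (lam z : ℂ_[p]) : ℂ_[p] :=
  benedettoMap lam z + evalSeries Q z

/-- `z` is a fixed point of `Q*_λ` with `|z - 1| ≤ |Q(1)| / p`. -/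
def IsFixedPointNearOne (Q : PowerSeries ℂ_[p]) (lam z : ℂ_[p]) : Prop :=
  ‖z - 1‖ ≤ ‖evalSeries Q 1‖ / p ∧ perturbedMap Q lam z = z

/-- `h(λ)`: the fixed point of `Q*_λ` in the closed ball of center `1` and radius `|Q(1)| / p`. -/
def fixedPointNearOne (Q : PowerSeries ℂ_[p]) (lam : ℂ_[p]) : ℂ_[p] :=
  Classical.epsilon (IsFixedPointNearOne Q lam)

/-- The translation `A_λ(z) = z + (h(λ) - 1)`. -/
def translation (Q : PowerSeries ℂ_[p]) (lam : ℂ_[p]) : ℂ_[p] ≃ ℂ_[p] :=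
  Equiv.addRight (fixedPointNearOne Q lam - 1)

/-- `Q_λ = A_λ⁻¹ ∘ Q*_λ ∘ A_λ`. -/
def conjugatedMap (Q : PowerSeries ℂ_[p]) (lam : ℂ_[p]) : ℂ_[p] → ℂ_[p] :=
  (translation Q lam).symm ∘ perturbedMap Q lam ∘ translation Q lam

end Family

end WanderingDisc

end

/-! Write `f_λ = P_λ + G` with `|G| ≤ q < ρ` and `G` `q`-Lipschitz. Three regions matter. The disc
`|z| ≤ ρ` is mapped into itself. In the annulus `ρ < |z| < 1` one has `|f_λ(z)| = p|z|^p > |z|`;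
there points at distance at most `p⁻²` are brought closer by a factor `κ = p^{-1/p}` when the image
has norm at most `κ`, and are not spread apart when it has norm `1` (`norm_perturb_sub_le_max`). In
`|z - 1| < 1`, which contains the fixed point `h(λ)`, distances are multiplied by exactly `p`
(`norm_perturb_sub_of_near_one`).

Suppose an orbit makes infinitely many rounds: `m + 1` steps in the annulus, then `M` steps near
`1`, with `κ^m p^M ≤ 1` and `m` unbounded. A disc of radius `p⁻²` about a point at the start of a
round never grows beyond `p⁻²`, so all its points have the same itinerary with respect to `{|z| <
1}`. Arbitrarily long stays in the annulus, each followed by an exit, make that itinerary not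
eventually periodic. If two iterates of the disc met, or if an orbit in the disc converged to a
cycle, it would be eventually periodic (`HasRounds.isAperiodicDisc`,
`IsAperiodicDisc.not_tendsto_iterate`).

Such parameters are found near any given one by nested discs. On a disc of radius `|c|/p^k`, with `1
< |c| < p`, the map `λ ↦ f_λ^n(x)` multiplies distances by `p^k`, so its image is large enough to
contain points near `0` and points of norm above `1`. Hence some parameter sends the orbit through
the annulus to a point very close to `h(λ)`. The passage wears off the old dilation, and its last
step leaves an isometry in `λ`; the stay near `1` then restores a dilation, by `p^{k+3}`, on a
smaller disc (`exists_round`). The required parameters exist because a uniform limit of polynomials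
with nonconstant norm on a ball takes arbitrarily small values (`IsPolyLimit.exists_norm_lt`). The
intersection point of the nested discs makes all the rounds (`exists_hasRounds`). -/

noncomputable section

namespace WanderingDisc

/-! ### Ultrametric inequalities. -/

section Ultrametric

variable {K : Type*} [NormedField K] [IsUltrametricDist K]

lemma norm_add_le_of_le {x y : K} {b : ℝ} (hx : ‖x‖ ≤ b) (hy : ‖y‖ ≤ b) : ‖x + y‖ ≤ b :=
  (IsUltrametricDist.norm_add_le_max x y).trans (max_le hx hy)

lemma norm_sub_le_of_le {x y : K} {b : ℝ} (hx : ‖x‖ ≤ b) (hy : ‖y‖ ≤ b) : ‖x - y‖ ≤ b := by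
  rw [sub_eq_add_neg]
  exact norm_add_le_of_le hx (by rwa [norm_neg])

lemma norm_add_lt_of_lt {x y : K} {b : ℝ} (hx : ‖x‖ < b) (hy : ‖y‖ < b) : ‖x + y‖ < b :=
  (IsUltrametricDist.norm_add_le_max x y).trans_lt (max_lt hx hy)

lemma norm_sub_lt_of_lt {x y : K} {b : ℝ} (hx : ‖x‖ < b) (hy : ‖y‖ < b) : ‖x - y‖ < b := by
  rw [sub_eq_add_neg]
  exact norm_add_lt_of_lt hx (by rwa [norm_neg])

lemma norm_add_eq_of_lt {x y : K} (h : ‖x‖ < ‖y‖) : ‖x + y‖ = ‖y‖ := by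
  refine le_antisymm (norm_add_le_of_le h.le le_rfl) (not_lt.1 fun h' => ?_)
  have := norm_sub_lt_of_lt h' h
  simp at this

lemma norm_eq_of_norm_sub_lt {x y : K} (h : ‖x - y‖ < ‖y‖) : ‖x‖ = ‖y‖ := by
  simpa using norm_add_eq_of_lt h

lemma norm_sub_le_trans {x y z : K} {b : ℝ} (hx : ‖x - y‖ ≤ b) (hy : ‖y - z‖ ≤ b) :
    ‖x - z‖ ≤ b := by
  simpa using norm_add_le_of_le hx hy

lemma norm_eq_one_of_norm_sub_one_lt {x : K} (h : ‖x - 1‖ < 1) : ‖x‖ = 1 := by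
  simpa using norm_eq_of_norm_sub_lt (x := x) (y := 1) (by simpa using h)

lemma norm_pow_sub_pow_le_mul {x y : K} {b : ℝ} (hx : ‖x‖ ≤ b) (hy : ‖y‖ ≤ b) (n : ℕ) :
    ‖x ^ (n + 1) - y ^ (n + 1)‖ ≤ b ^ n * ‖x - y‖ := by
  have hb : 0 ≤ b := (norm_nonneg x).trans hx
  induction n with
  | zero => simp
  | succ n ih =>
    have h : x ^ (n + 1 + 1) - y ^ (n + 1 + 1) =
      (x ^ (n + 1) - y ^ (n + 1)) * x + y ^ (n + 1) * (x - y) := by ring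
    rw [h]
    refine norm_add_le_of_le ?_ ?_
    · rw [norm_mul, pow_succ b, mul_right_comm]
      exact mul_le_mul ih hx (norm_nonneg _) (by positivity)
    · rw [norm_mul, norm_pow]
      gcongr

lemma norm_pow_sub_pow_le {x y : K} (hx : ‖x‖ ≤ 1) (hy : ‖y‖ ≤ 1) (n : ℕ) :
    ‖x ^ n - y ^ n‖ ≤ ‖x - y‖ := by
  cases n with
  | zero => simp
  | succ n => simpa using norm_pow_sub_pow_le_mul hx hy n

end Ultrametric

/-! ### Uniform limits of polynomials and their small values. -/

section PolyLimit

variable {K : Type*} [NontriviallyNormedField K]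

/-- `g` is bounded on `E` and is a uniform limit on `E` of polynomial functions. -/
structure IsPolyLimit (E : Set K) (g : K → K) : Prop where
  bounded : ∃ b, ∀ x ∈ E, ‖g x‖ ≤ b
  approx : ∀ η : ℝ, 0 < η → ∃ a : Polynomial K, ∀ x ∈ E, ‖g x - a.eval x‖ ≤ η

namespace IsPolyLimit

variable {E E' : Set K} {f g : K → K}

lemma mono (hg : IsPolyLimit E g) (h : E' ⊆ E) : IsPolyLimit E' g where
  bounded := hg.bounded.imp fun _ hb x hx => hb x (h hx)
  approx η hη := (hg.approx η hη).imp fun _ ha x hx => ha x (h hx)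

lemma const (c : K) : IsPolyLimit E fun _ => c where
  bounded := ⟨‖c‖, fun _ _ => le_rfl⟩
  approx η hη := ⟨Polynomial.C c, fun x _ => by simpa using hη.le⟩

variable [IsUltrametricDist K]

lemma id (c : K) (R : ℝ) : IsPolyLimit (closedBall c R) fun x => x where
  bounded := ⟨max R ‖c‖, fun x hx => by
    rw [mem_closedBall, dist_eq_norm] at hx
    simpa using norm_add_le_of_le (hx.trans (le_max_left R ‖c‖)) (le_max_right R ‖c‖)⟩
  approx η hη := ⟨Polynomial.X, fun x _ => by simpa using hη.le⟩

lemma add (hf : IsPolyLimit E f) (hg : IsPolyLimit E g) : IsPolyLimit E fun x => f x + g x where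
  bounded := by
    obtain ⟨b, hb⟩ := hf.bounded
    obtain ⟨c, hc⟩ := hg.bounded
    exact ⟨max b c, fun x hx => norm_add_le_of_le ((hb x hx).trans (le_max_left _ _))
      ((hc x hx).trans (le_max_right _ _))⟩
  approx η hη := by
    obtain ⟨a, ha⟩ := hf.approx η hη
    obtain ⟨b, hb⟩ := hg.approx η hη
    refine ⟨a + b, fun x hx => ?_⟩
    rw [Polynomial.eval_add, add_sub_add_comm]
    exact norm_add_le_of_le (ha x hx) (hb x hx)

lemma mul (hf : IsPolyLimit E f) (hg : IsPolyLimit E g) : IsPolyLimit E fun x => f x * g x := by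
  obtain ⟨b, hb⟩ := hf.bounded
  obtain ⟨c, hc⟩ := hg.bounded
  refine ⟨⟨|b| * |c|, fun x hx => ?_⟩, fun η hη => ?_⟩
  · rw [norm_mul]
    exact mul_le_mul ((hb x hx).trans (le_abs_self b)) ((hc x hx).trans (le_abs_self c))
      (norm_nonneg _) (abs_nonneg _)
  · have hb' : 0 < |b| + 1 := by positivity
    have hc' : 0 < |c| + 1 := by positivity
    obtain ⟨u, hu⟩ := hf.approx (min 1 (η / (|c| + 1))) (by positivity)
    obtain ⟨w, hw⟩ := hg.approx (min 1 (η / (|b| + 1))) (by positivity)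
    refine ⟨u * w, fun x hx => ?_⟩
    have hw1 : ‖w.eval x‖ ≤ |c| + 1 := by
      have h1 := norm_sub_le (g x) (g x - w.eval x)
      rw [sub_sub_cancel] at h1
      linarith [hc x hx, le_abs_self c, (hw x hx).trans (min_le_left _ _)]
    rw [Polynomial.eval_mul, show f x * g x - u.eval x * w.eval x =
      f x * (g x - w.eval x) + (f x - u.eval x) * w.eval x by ring]
    refine norm_add_le_of_le ?_ ?_
    · rw [norm_mul]
      calc ‖f x‖ * ‖g x - w.eval x‖ ≤ (|b| + 1) * (η / (|b| + 1)) :=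
            mul_le_mul (by linarith [hb x hx, le_abs_self b]) ((hw x hx).trans (min_le_right _ _))
              (norm_nonneg _) hb'.le
        _ = η := by field_simp
    · rw [norm_mul]
      calc ‖f x - u.eval x‖ * ‖w.eval x‖ ≤ (η / (|c| + 1)) * (|c| + 1) :=
            mul_le_mul ((hu x hx).trans (min_le_right _ _)) hw1 (norm_nonneg _) (by positivity)
        _ = η := by field_simp

lemma sub (hf : IsPolyLimit E f) (hg : IsPolyLimit E g) : IsPolyLimit E fun x => f x - g x := by
  simpa [sub_eq_add_neg] using hf.add ((const (-1)).mul hg)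

lemma pow (hf : IsPolyLimit E f) (n : ℕ) : IsPolyLimit E fun x => f x ^ n := by
  induction n with
  | zero => simpa using const (E := E) 1
  | succ n ih => simpa [pow_succ] using ih.mul hf

lemma of_uniform (h : ∀ η : ℝ, 0 < η → ∃ f, IsPolyLimit E f ∧ ∀ x ∈ E, ‖g x - f x‖ ≤ η) :
    IsPolyLimit E g where
  bounded := by
    obtain ⟨f, hf, hfg⟩ := h 1 one_pos
    obtain ⟨b, hb⟩ := hf.bounded
    refine ⟨max 1 b, fun x hx => ?_⟩
    simpa using norm_add_le_of_le ((hfg x hx).trans (le_max_left 1 b))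
      ((hb x hx).trans (le_max_right 1 b))
  approx η hη := by
    obtain ⟨f, hf, hfg⟩ := h η hη
    obtain ⟨a, ha⟩ := hf.approx η hη
    exact ⟨a, fun x hx => norm_sub_le_trans (hfg x hx) (ha x hx)⟩

lemma poly_comp (hf : IsPolyLimit E f) (a : Polynomial K) :
    IsPolyLimit E fun x => a.eval (f x) := by
  induction a using Polynomial.induction_on' with
  | add a b ha hb => simpa using ha.add hb
  | monomial n c => simpa using (const c).mul (hf.pow n)

lemma comp (hg : IsPolyLimit E' g) (hf : IsPolyLimit E f) (h : ∀ x ∈ E, f x ∈ E') :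
    IsPolyLimit E fun x => g (f x) :=
  of_uniform fun η hη => by
    obtain ⟨a, ha⟩ := hg.approx η hη
    exact ⟨_, hf.poly_comp a, fun x hx => ha _ (h x hx)⟩

end IsPolyLimit

variable [IsUltrametricDist K]

/-- All roots `s` lie outside the ball, so `|x - s| = |y - s|` for `x`, `y` inside; factor the
polynomial over its roots. -/
lemma norm_eval_eq_of_forall_ne_zero [IsAlgClosed K] (a : Polynomial K) {c : K} {R : ℝ}
    (h : ∀ x ∈ closedBall c R, a.eval x ≠ 0) {x y : K} (hx : x ∈ closedBall c R)
    (hy : y ∈ closedBall c R) : ‖a.eval x‖ = ‖a.eval y‖ := by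
  have key : ∀ z, ‖a.eval z‖ =
      ‖a.leadingCoeff‖ * (a.roots.map fun s => ‖z - s‖).prod := by
    intro z
    conv_lhs => rw [(IsAlgClosed.splits a).eq_prod_roots]
    rw [Polynomial.eval_mul, Polynomial.eval_C, norm_mul, Polynomial.eval_multiset_prod,
      Multiset.map_map]
    congr 1
    refine (map_multiset_prod (normHom : K →*₀ ℝ) _).trans ?_
    simp [Multiset.map_map]
  rw [key, key]
  congr 2
  refine Multiset.map_congr rfl fun s hs => ?_
  have hs' : s ∉ closedBall c R := fun hc => h s hc (Polynomial.isRoot_of_mem_roots hs)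
  have hlt : ‖x - y‖ < ‖y - s‖ := by
    simp only [mem_closedBall, dist_eq_norm] at hx hy hs'
    by_contra! hle
    have hxy : ‖x - y‖ ≤ R := norm_sub_le_trans hx (by rwa [norm_sub_rev])
    exact hs' (norm_sub_le_trans (y := y) (by rw [norm_sub_rev]; exact hle.trans hxy) hy)
  have := norm_add_eq_of_lt hlt
  simpa using this

/-- Approximate zeros suffice for the whole construction. If `|g|` were bounded below by `η`, a
polynomial within `η / 2` of `g` would have the same norm as `g` everywhere on the ball, hence no
zero there, hence constant norm. -/
lemma IsPolyLimit.exists_norm_lt [IsAlgClosed K] {g : K → K} {c : K} {R : ℝ}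
    (hg : IsPolyLimit (closedBall c R) g) {x y : K} (hx : x ∈ closedBall c R)
    (hy : y ∈ closedBall c R) (hxy : ‖g x‖ ≠ ‖g y‖) {η : ℝ} (hη : 0 < η) :
    ∃ z ∈ closedBall c R, ‖g z‖ < η := by
  by_contra! hge
  obtain ⟨a, ha⟩ := hg.approx (η / 2) (half_pos hη)
  have heq : ∀ z ∈ closedBall c R, ‖a.eval z‖ = ‖g z‖ := fun z hz =>
    norm_eq_of_norm_sub_lt (by
      rw [norm_sub_rev]; exact (ha z hz).trans_lt ((half_lt_self hη).trans_le (hge z hz)))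
  refine hxy ?_
  rw [← heq x hx, ← heq y hy]
  refine norm_eval_eq_of_forall_ne_zero a (fun z hz h0 => ?_) hx hy
  have := hge z hz
  rw [← heq z hz, h0, norm_zero] at this
  linarith

end PolyLimit

/-! ### The radii `ρ` and `κ`. -/

section Constants

lemma mul_pow_le_mul_pow {p : ℕ} {s s' : ℝ} (hs : 0 ≤ s) (h : s ≤ s') :
    (p : ℝ) * s ^ p ≤ p * s' ^ p := by gcongr

variable (p : ℕ) [Fact p.Prime]

/-- The real number `p^{-1/p}`, the positive solution of `p κ^p = 1`. -/
def kappa : ℝ := (p : ℝ) ^ (-(1 / (p : ℝ)))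

lemma two_le_cast : (2 : ℝ) ≤ p := by exact_mod_cast (Fact.out : p.Prime).two_le

lemma cast_pos' : (0 : ℝ) < p := by linarith [two_le_cast p]

lemma rho_pos : 0 < rho p := Real.rpow_pos_of_pos (cast_pos' p) _

lemma kappa_pos : 0 < kappa p := Real.rpow_pos_of_pos (cast_pos' p) _

lemma rho_lt_one : rho p < 1 := by
  have := two_le_cast p
  refine Real.rpow_lt_one_of_one_lt_of_neg (by linarith) ?_
  have : 0 < 1 / ((p : ℝ) - 1) := by apply div_pos one_pos; linarith
  linarith

lemma kappa_lt_one : kappa p < 1 := by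
  have := two_le_cast p
  refine Real.rpow_lt_one_of_one_lt_of_neg (by linarith) ?_
  have : 0 < 1 / (p : ℝ) := by positivity
  linarith

lemma mul_rho_pow : (p : ℝ) * rho p ^ p = rho p := by
  have h2 := two_le_cast p
  have h1 : (p : ℝ) - 1 ≠ 0 := by linarith
  rw [rho, ← Real.rpow_natCast, ← Real.rpow_mul (cast_pos' p).le]
  nth_rewrite 1 [← Real.rpow_one (p : ℝ)]
  rw [← Real.rpow_add (cast_pos' p)]
  congr 1
  field_simp
  ring

lemma mul_kappa_pow : (p : ℝ) * kappa p ^ p = 1 := by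
  have h2 := two_le_cast p
  rw [kappa, ← Real.rpow_natCast, ← Real.rpow_mul (cast_pos' p).le]
  nth_rewrite 1 [← Real.rpow_one (p : ℝ)]
  rw [← Real.rpow_add (cast_pos' p)]
  convert Real.rpow_zero (p : ℝ) using 2
  field_simp
  ring

variable {p}

lemma mul_pow_lt_mul_pow {s s' : ℝ} (hs : 0 ≤ s) (h : s < s') :
    (p : ℝ) * s ^ p < p * s' ^ p :=
  mul_lt_mul_of_pos_left (pow_lt_pow_left₀ h hs (Fact.out : p.Prime).ne_zero) (cast_pos' p)

lemma le_kappa_of_mul_pow_le_one {s : ℝ} (h : p * s ^ p ≤ 1) : s ≤ kappa p := by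
  by_contra! hlt
  have := mul_pow_lt_mul_pow (p := p) (kappa_pos p).le hlt
  rw [mul_kappa_pow] at this
  linarith

lemma rho_lt_mul_pow {s : ℝ} (h : rho p < s) : rho p < p * s ^ p := by
  simpa [mul_rho_pow] using mul_pow_lt_mul_pow (p := p) (rho_pos p).le h

variable (p)

lemma rho_lt_kappa : rho p < kappa p := by
  by_contra! hle
  have := mul_pow_le_mul_pow (p := p) (kappa_pos p).le hle
  rw [mul_kappa_pow, mul_rho_pow] at this
  linarith [rho_lt_one p]

lemma inv_le_kappa : (p : ℝ)⁻¹ ≤ kappa p := by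
  have h2 := two_le_cast p
  refine le_kappa_of_mul_pow_le_one ?_
  have : ((p : ℝ)⁻¹) ^ p ≤ (p : ℝ)⁻¹ :=
    pow_le_of_le_one (by positivity) (inv_le_one_of_one_le₀ (by linarith))
      (Fact.out : p.Prime).ne_zero
  calc (p : ℝ) * (p : ℝ)⁻¹ ^ p ≤ p * (p : ℝ)⁻¹ := by gcongr
    _ = 1 := mul_inv_cancel₀ (by linarith)

lemma inv_sq_lt_rho : ((p : ℝ) ^ 2)⁻¹ < rho p := by
  have h2 := two_le_cast p
  have h : ((p : ℝ) ^ 2)⁻¹ = (p : ℝ) ^ (-(2 : ℝ)) := by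
    rw [Real.rpow_neg (cast_pos' p).le]; norm_cast
  rw [h, rho]
  refine Real.rpow_lt_rpow_of_exponent_lt (by linarith) ?_
  have : 1 / ((p : ℝ) - 1) ≤ 1 := by
    rw [div_le_one (by linarith)]; linarith
  linarith

lemma inv_sq_lt_one : ((p : ℝ) ^ 2)⁻¹ < 1 := (inv_sq_lt_rho p).trans (rho_lt_one p)

lemma inv_sq_pos : 0 < ((p : ℝ) ^ 2)⁻¹ := inv_pos.2 (pow_pos (cast_pos' p) 2)

variable {p}

/-- This fixes the working scale `p⁻²`: there `p d^p ≤ (p d) d` and `p d ≤ 1/p ≤ κ`. -/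
lemma mul_pow_le_kappa_mul {d : ℝ} (h0 : 0 ≤ d) (hd : d ≤ ((p : ℝ) ^ 2)⁻¹) :
    p * d ^ p ≤ kappa p * d := by
  have h2 := two_le_cast p
  have h1 : d ^ p ≤ d ^ 2 :=
    pow_le_pow_of_le_one h0 (hd.trans (inv_sq_lt_one p).le) (Fact.out : p.Prime).two_le
  have h3 : p * d ≤ kappa p := by
    refine le_trans ?_ (inv_le_kappa p)
    calc (p : ℝ) * d ≤ p * ((p : ℝ) ^ 2)⁻¹ := by gcongr
      _ = (p : ℝ)⁻¹ := by field_simp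
  nlinarith

end Constants

/-! ### Differences of `p`-th powers. -/

section PrimePower

variable {p : ℕ} [Fact p.Prime] {K : Type*} [NontriviallyNormedField K] [IsUltrametricDist K]

/-- Expand `((z - w) + w)^p`: the middle binomial coefficients are divisible by `p`, and each middle
monomial has a factor `z - w` and a factor `w`. -/
lemma norm_pow_prime_sub_le (hp : ‖(p : K)‖ = (p : ℝ)⁻¹) {z w : K} {s : ℝ} (hs : ‖w‖ ≤ s)
    (hs1 : s ≤ 1) (hd : ‖z - w‖ ≤ 1) :
    ‖z ^ p - w ^ p‖ ≤ max (‖z - w‖ ^ p) ((p : ℝ)⁻¹ * (s * ‖z - w‖)) := by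
  have hs0 : 0 ≤ s := (norm_nonneg w).trans hs
  have h := add_pow_prime_eq' (Fact.out : p.Prime) (z - w) w
  rw [sub_add_cancel] at h
  rw [h, add_right_comm, add_sub_cancel_right]
  refine norm_add_le_of_le ?_ ?_
  · rw [norm_pow]; exact le_max_left _ _
  · refine le_trans ?_ (le_max_right _ _)
    rw [norm_mul, hp]
    gcongr
    refine IsUltrametricDist.norm_sum_le_of_forall_le_of_nonneg (by positivity) fun k hk => ?_
    rw [Finset.mem_Ioo] at hk
    rw [norm_mul, norm_mul, norm_pow, norm_pow]
    calc ‖z - w‖ ^ k * ‖w‖ ^ (p - k) * ‖((p.choose k / p : ℕ) : K)‖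
        ≤ ‖z - w‖ * s * 1 := by
          gcongr
          · exact pow_le_of_le_one (norm_nonneg _) hd (by omega)
          · exact (pow_le_of_le_one (norm_nonneg _) (hs.trans hs1) (by omega)).trans hs
          · exact IsUltrametricDist.norm_natCast_le_one K _
      _ = s * ‖z - w‖ := by ring

end PrimePower

/-! ### Norm and distance estimates for one step of the map. -/

/-- The map `G` is a small perturbation on the closed ball of radius `r`: a uniform limit of
polynomials which is bounded by `q < ρ` and `q`-Lipschitz. -/
structure IsSmallPerturbation (p : ℕ) [Fact p.Prime] {K : Type*} [NontriviallyNormedField K]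
    (r q : ℝ) (G : K → K) : Prop where
  norm_p : ‖(p : K)‖ = (p : ℝ)⁻¹
  one_lt : 1 < r
  nonneg : 0 ≤ q
  lt_rho : q < rho p
  norm_le : ∀ z, ‖z‖ ≤ r → ‖G z‖ ≤ q
  lipschitz : ∀ z w, ‖z‖ ≤ r → ‖w‖ ≤ r → ‖G z - G w‖ ≤ q * ‖z - w‖
  polyLimit : IsPolyLimit (closedBall 0 r) G

/-- The map `z ↦ P_λ(z) + G(z)`. -/
def perturb (p : ℕ) {K : Type*} [NontriviallyNormedField K] (G : K → K) (lam z : K) : K :=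
  lam / (p : K) * z ^ p + (1 - lam / (p : K)) * z ^ (p + 1) + G z

namespace IsSmallPerturbation

variable {p : ℕ} [Fact p.Prime] {K : Type*} [NontriviallyNormedField K]
  {r q : ℝ} {G : K → K} {lam mu z w : K}

lemma p_ne_zero (S : IsSmallPerturbation p r q G) : (p : K) ≠ 0 := by
  rw [← norm_ne_zero_iff, S.norm_p]
  exact inv_ne_zero (cast_pos' p).ne'

lemma lt_one (S : IsSmallPerturbation p r q G) : q < 1 := S.lt_rho.trans (rho_lt_one p)

lemma norm_le' (S : IsSmallPerturbation p r q G) (hz : ‖z‖ ≤ 1) : ‖G z‖ ≤ q :=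
  S.norm_le z (hz.trans S.one_lt.le)

lemma lipschitz' (S : IsSmallPerturbation p r q G) (hz : ‖z‖ ≤ 1) (hw : ‖w‖ ≤ 1) :
    ‖G z - G w‖ ≤ q * ‖z - w‖ :=
  S.lipschitz z w (hz.trans S.one_lt.le) (hw.trans S.one_lt.le)

lemma perturb_sub_perturb_param (S : IsSmallPerturbation p r q G) :
    perturb p G lam z - perturb p G mu z = (lam - mu) / p * (z ^ p * (1 - z)) := by
  have := S.p_ne_zero
  simp only [perturb]
  field_simp
  ring

variable [IsUltrametricDist K]

lemma norm_perturb_sub_param (S : IsSmallPerturbation p r q G) (hz : ‖z‖ < 1) :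
    ‖perturb p G lam z - perturb p G mu z‖ = ‖lam - mu‖ * (p * ‖z‖ ^ p) := by
  have h1 : ‖1 - z‖ = 1 := norm_eq_one_of_norm_sub_one_lt (by simpa using hz)
  rw [S.perturb_sub_perturb_param, norm_mul, norm_div, norm_mul, norm_pow, S.norm_p, h1]
  field_simp

/-- The difference is `z^p / p` times an element congruent to `1` modulo the open unit ball. -/
lemma norm_perturb_sub_map (S : IsSmallPerturbation p r q G) (hl : ‖lam - 1‖ < 1)
    (hz : ‖z‖ < 1) : ‖perturb p G lam z - G z‖ = p * ‖z‖ ^ p := by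
  have hp1 : ‖(p : K)‖ < 1 := by
    rw [S.norm_p]; exact (inv_le_kappa p).trans_lt (kappa_lt_one p)
  have h : perturb p G lam z - G z =
      z ^ p / p * (1 + ((lam - 1) * (1 - z) + (p * z - z))) := by
    have := S.p_ne_zero
    simp only [perturb]
    field_simp
    ring
  have h1 : ‖1 - z‖ = 1 := norm_eq_one_of_norm_sub_one_lt (by simpa using hz)
  have h2 : ‖1 + ((lam - 1) * (1 - z) + (p * z - z))‖ = 1 := by
    refine norm_eq_one_of_norm_sub_one_lt ?_
    rw [add_sub_cancel_left]
    refine norm_add_lt_of_lt (by rwa [norm_mul, h1, mul_one]) (norm_sub_lt_of_lt ?_ hz)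
    rw [norm_mul]
    nlinarith [norm_nonneg z, norm_nonneg (p : K)]
  rw [h, norm_mul, h2, norm_div, S.norm_p, norm_pow]
  field_simp

lemma norm_perturb (S : IsSmallPerturbation p r q G) (hl : ‖lam - 1‖ < 1) (hz : ‖z‖ < 1)
    (hq : q < p * ‖z‖ ^ p) : ‖perturb p G lam z‖ = p * ‖z‖ ^ p := by
  have h := norm_add_eq_of_lt (x := G z) (y := perturb p G lam z - G z)
    (by rw [S.norm_perturb_sub_map hl hz]; exact (S.norm_le' hz.le).trans_lt hq)
  rwa [add_sub_cancel, S.norm_perturb_sub_map hl hz] at h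

lemma norm_perturb_le (S : IsSmallPerturbation p r q G) (hl : ‖lam - 1‖ < 1) (hz : ‖z‖ < 1) :
    ‖perturb p G lam z‖ ≤ max q (p * ‖z‖ ^ p) := by
  have h := norm_add_le_of_le (x := G z) (y := perturb p G lam z - G z)
    ((S.norm_le' hz.le).trans (le_max_left _ _)) ((S.norm_perturb_sub_map hl hz).le.trans
      (le_max_right _ _))
  rwa [add_sub_cancel] at h

lemma norm_perturb_le_rho (S : IsSmallPerturbation p r q G) (hl : ‖lam - 1‖ < 1)
    (hz : ‖z‖ ≤ rho p) : ‖perturb p G lam z‖ ≤ rho p := by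
  refine (S.norm_perturb_le hl (hz.trans_lt (rho_lt_one p))).trans (max_le S.lt_rho.le ?_)
  simpa [mul_rho_pow] using mul_pow_le_mul_pow (p := p) (norm_nonneg z) hz

lemma norm_perturb_of_rho_lt (S : IsSmallPerturbation p r q G) (hl : ‖lam - 1‖ < 1)
    (hz : rho p < ‖z‖) (hz1 : ‖z‖ < 1) : ‖perturb p G lam z‖ = p * ‖z‖ ^ p :=
  S.norm_perturb hl hz1 (S.lt_rho.trans (rho_lt_mul_pow hz))

lemma norm_lt_one_of_sub (hw : ‖w‖ < 1) (hd : ‖z - w‖ ≤ ((p : ℝ) ^ 2)⁻¹) : ‖z‖ < 1 := by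
  simpa using norm_add_lt_of_lt (hd.trans_lt (inv_sq_lt_one p)) hw

lemma norm_eq_of_sub (hw : rho p < ‖w‖) (hd : ‖z - w‖ ≤ ((p : ℝ) ^ 2)⁻¹) : ‖z‖ = ‖w‖ :=
  norm_eq_of_norm_sub_lt (hd.trans_lt ((inv_sq_lt_rho p).trans hw))

lemma norm_perturb_sub_le (S : IsSmallPerturbation p r q G) (hl : ‖lam - 1‖ < 1)
    (hz : ‖z‖ ≤ 1) (hw : ‖w‖ ≤ 1) :
    ‖perturb p G lam z - perturb p G lam w‖ ≤ p * ‖z - w‖ := by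
  have h2 := two_le_cast p
  have hlam : ‖lam‖ = 1 := norm_eq_one_of_norm_sub_one_lt hl
  have hlp : ‖lam / (p : K)‖ = p := by rw [norm_div, hlam, S.norm_p]; simp
  have h : perturb p G lam z - perturb p G lam w = lam / (p : K) * (z ^ p - w ^ p) +
      ((1 - lam / (p : K)) * (z ^ (p + 1) - w ^ (p + 1)) + (G z - G w)) := by
    simp only [perturb]; ring
  have hlp' : ‖1 - lam / (p : K)‖ ≤ p :=
    norm_sub_le_of_le (by rw [norm_one]; linarith) hlp.le
  rw [h]
  refine norm_add_le_of_le ?_ (norm_add_le_of_le ?_ ?_)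
  · rw [norm_mul, hlp]
    gcongr
    exact norm_pow_sub_pow_le hz hw p
  · rw [norm_mul]
    gcongr
    exact norm_pow_sub_pow_le hz hw (p + 1)
  · refine (S.lipschitz' hz hw).trans ?_
    gcongr
    linarith [S.lt_one]

/-- The dominant part of the difference is `λ/p` times `(z^p - w^p)(1 - z) - w^p (z - w)`. The
binomial estimate bounds the first product by `κ`; the second contributes `p|w|^p`, the norm of the
image of `w` in the annulus. So the step contracts by `κ` if that image has norm at most `κ`, and
does not expand if it has norm `1`. -/
lemma norm_perturb_sub_le_max (S : IsSmallPerturbation p r q G) (hl : ‖lam - 1‖ < 1)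
    (hw1 : ‖w‖ < 1) (hw' : p * ‖w‖ ^ p ≤ 1)
    (hd : ‖z - w‖ ≤ ((p : ℝ) ^ 2)⁻¹) :
    ‖perturb p G lam z - perturb p G lam w‖ ≤ max (kappa p) (p * ‖w‖ ^ p) * ‖z - w‖ := by
  have h2 := two_le_cast p
  have hz1 : ‖z‖ < 1 := norm_lt_one_of_sub hw1 hd
  have hlam : ‖lam‖ = 1 := norm_eq_one_of_norm_sub_one_lt hl
  have hlp : ‖lam / (p : K)‖ = p := by rw [norm_div, hlam, S.norm_p]; simp
  have h1z : ‖1 - z‖ = 1 := norm_eq_one_of_norm_sub_one_lt (by simpa using hz1)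
  have hpow : p * ‖z ^ p - w ^ p‖ ≤ kappa p * ‖z - w‖ := by
    have h := norm_pow_prime_sub_le S.norm_p (le_kappa_of_mul_pow_le_one hw') (kappa_lt_one p).le
      (hd.trans (inv_sq_lt_one p).le)
    refine (mul_le_mul_of_nonneg_left h (cast_pos' p).le).trans ?_
    rw [mul_max_of_nonneg _ _ (cast_pos' p).le]
    refine max_le (mul_pow_le_kappa_mul (norm_nonneg _) hd) (le_of_eq ?_)
    field_simp
  have hpow' : ‖z ^ p - w ^ p‖ ≤ kappa p * ‖z - w‖ :=
    (le_mul_of_one_le_left (norm_nonneg _) (by linarith)).trans hpow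
  have hwp : ‖w ^ p‖ ≤ p * ‖w‖ ^ p := by
    rw [norm_pow]; exact le_mul_of_one_le_left (by positivity) (by linarith)
  have h : perturb p G lam z - perturb p G lam w =
      lam / (p : K) * ((z ^ p - w ^ p) * (1 - z)) - lam / (p : K) * (w ^ p * (z - w)) +
      ((z ^ p - w ^ p) * z + w ^ p * (z - w) + (G z - G w)) := by
    simp only [perturb]; ring
  have hk : kappa p * ‖z - w‖ ≤ max (kappa p) (p * ‖w‖ ^ p) * ‖z - w‖ := by
    gcongr; exact le_max_left _ _
  have hp' : p * ‖w‖ ^ p * ‖z - w‖ ≤ max (kappa p) (p * ‖w‖ ^ p) * ‖z - w‖ := by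
    gcongr; exact le_max_right _ _
  rw [h]
  refine norm_add_le_of_le (norm_sub_le_of_le ?_ ?_)
    (norm_add_le_of_le (norm_add_le_of_le ?_ ?_) ?_)
  · rw [norm_mul, norm_mul, hlp, h1z, mul_one]
    exact hpow.trans hk
  · rw [norm_mul, norm_mul, hlp, norm_pow, ← mul_assoc]
    exact hp'
  · rw [norm_mul]
    exact (mul_le_of_le_one_right (norm_nonneg _) hz1.le).trans (hpow'.trans hk)
  · rw [norm_mul]
    exact le_trans (by gcongr) hp'
  · refine (S.lipschitz' hz1.le hw1.le).trans (le_trans ?_ hk)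
    gcongr
    exact (S.lt_rho.trans (rho_lt_kappa p)).le

lemma norm_one_sub_div (S : IsSmallPerturbation p r q G) (hl : ‖lam - 1‖ < 1) :
    ‖1 - lam / (p : K)‖ = p := by
  have hlam : ‖lam‖ = 1 := norm_eq_one_of_norm_sub_one_lt hl
  have hlp : ‖lam / (p : K)‖ = p := by rw [norm_div, hlam, S.norm_p]; simp
  have := norm_add_eq_of_lt (x := (1 : K)) (y := -(lam / (p : K)))
    (by rw [norm_neg, hlp, norm_one]; linarith [two_le_cast p])
  rwa [norm_neg, hlp, ← sub_eq_add_neg] at this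

/-- The linear part of `P_λ` at `1` is `p + (1 - λ/p)(p + 1) - p(1 - λ/p)` up to terms of smaller
norm, that is, essentially `1 - λ/p`, of norm `p`. The rest has Lipschitz constant below `p` on a
ball of radius `m < 1`. -/
lemma norm_perturb_sub_linear_le (S : IsSmallPerturbation p r q G) (hl : ‖lam - 1‖ < 1)
    {m : ℝ} (hm : m < 1) (hz : ‖z - 1‖ ≤ m) (hw : ‖w - 1‖ ≤ m) :
    ‖perturb p G lam z - perturb p G lam w - (1 - lam / (p : K)) * (z - w)‖ ≤
      max 1 (p * m) * ‖z - w‖ := by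
  have hz1 := norm_eq_one_of_norm_sub_one_lt (hz.trans_lt hm)
  have hw1 := norm_eq_one_of_norm_sub_one_lt (hw.trans_lt hm)
  have h : perturb p G lam z - perturb p G lam w - (1 - lam / (p : K)) * (z - w) =
      (z ^ p - w ^ p) + (1 - lam / (p : K)) * ((z - w) * (z ^ p - 1) +
        (w - 1) * (z ^ p - w ^ p)) + (G z - G w) := by
    simp only [perturb]; ring
  have hpow := norm_pow_sub_pow_le hz1.le hw1.le p
  have h1 : 1 * ‖z - w‖ ≤ max 1 (p * m) * ‖z - w‖ := by gcongr; exact le_max_left _ _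
  have h2 : p * m * ‖z - w‖ ≤ max 1 (p * m) * ‖z - w‖ := by gcongr; exact le_max_right _ _
  rw [h]
  refine norm_add_le_of_le (norm_add_le_of_le ?_ ?_) ?_
  · exact (hpow.trans (one_mul _).ge).trans h1
  · rw [norm_mul, S.norm_one_sub_div hl]
    refine le_trans ?_ h2
    rw [mul_assoc]
    gcongr
    refine norm_add_le_of_le ?_ ?_
    · rw [norm_mul, mul_comm]
      gcongr
      have := norm_pow_sub_pow_le (y := (1 : K)) hz1.le (by simp) p
      rw [one_pow] at this
      exact this.trans hz
    · rw [norm_mul]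
      gcongr
      exact (norm_nonneg _).trans hw
  · refine (S.lipschitz' hz1.le hw1.le).trans (le_trans ?_ h1)
    gcongr
    exact S.lt_one.le

lemma norm_perturb_sub_of_near_one (S : IsSmallPerturbation p r q G) (hl : ‖lam - 1‖ < 1)
    (hz : ‖z - 1‖ < 1) (hw : ‖w - 1‖ < 1) :
    ‖perturb p G lam z - perturb p G lam w‖ = p * ‖z - w‖ := by
  rcases eq_or_ne z w with rfl | hne
  · simp
  have h2 := two_le_cast p
  have hpos : 0 < ‖z - w‖ := norm_pos_iff.2 (sub_ne_zero.2 hne)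
  have h := S.norm_perturb_sub_linear_le hl (max_lt hz hw) (le_max_left _ _) (le_max_right _ _)
  have hlin : ‖(1 - lam / (p : K)) * (z - w)‖ = p * ‖z - w‖ := by
    rw [norm_mul, S.norm_one_sub_div hl]
  rw [← hlin]
  refine norm_eq_of_norm_sub_lt (h.trans_lt ?_)
  rw [hlin]
  gcongr
  refine max_lt (by linarith) ?_
  have := max_lt hz hw
  nlinarith

end IsSmallPerturbation

/-! ### The fixed point near `1`. -/

/-- A map whose fixed points are those of `perturb p G lam` and which contracts a neighbourhood
of `1`. -/
def relaxation (p : ℕ) {K : Type*} [NontriviallyNormedField K] (G : K → K) (lam z : K) : K :=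
  z + p * (perturb p G lam z - z)

namespace IsSmallPerturbation

variable {p : ℕ} [Fact p.Prime] {K : Type*} [NontriviallyNormedField K]
  {r q : ℝ} {G : K → K} {lam mu z w : K}

lemma inv_lt_one : (p : ℝ)⁻¹ < 1 := (inv_le_kappa p).trans_lt (kappa_lt_one p)

lemma relaxation_eq_iff (S : IsSmallPerturbation p r q G) :
    relaxation p G lam z = z ↔ perturb p G lam z = z := by
  simp [relaxation, S.p_ne_zero, sub_eq_zero]

lemma norm_relaxation_one_sub (S : IsSmallPerturbation p r q G) :
    ‖relaxation p G lam 1 - 1‖ = ‖G 1‖ / p := by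
  have h : relaxation p G lam 1 - 1 = p * G 1 := by
    simp only [relaxation, perturb]; ring
  rw [h, norm_mul, S.norm_p, div_eq_inv_mul]

lemma norm_map_one_div_le (S : IsSmallPerturbation p r q G) : ‖G 1‖ / p ≤ (p : ℝ)⁻¹ := by
  rw [div_eq_inv_mul]
  refine mul_le_of_le_one_right (inv_nonneg.2 (cast_pos' p).le) ?_
  exact (S.norm_le' (by simp)).trans S.lt_one.le

variable [IsUltrametricDist K]

/-- The linear factor `1 - λ/p` becomes `1 + p((1 - λ/p) - 1) = 1 - λ`, small on `Λ`; the remaining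
part, `1`-Lipschitz on this ball, is multiplied by `p`. -/
lemma norm_relaxation_sub_le (S : IsSmallPerturbation p r q G) (hl : ‖lam - 1‖ < 1)
    (hz : ‖z - 1‖ ≤ (p : ℝ)⁻¹) (hw : ‖w - 1‖ ≤ (p : ℝ)⁻¹) :
    ‖relaxation p G lam z - relaxation p G lam w‖ ≤ max (p : ℝ)⁻¹ ‖lam - 1‖ * ‖z - w‖ := by
  have h := S.norm_perturb_sub_linear_le hl inv_lt_one hz hw
  rw [mul_inv_cancel₀ (cast_pos' p).ne', max_self, one_mul] at h
  have heq : relaxation p G lam z - relaxation p G lam w =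
      p * (perturb p G lam z - perturb p G lam w - (1 - lam / (p : K)) * (z - w)) -
        (lam - 1) * (z - w) := by
    have := S.p_ne_zero
    simp only [relaxation]
    field_simp
    ring
  rw [heq]
  refine norm_sub_le_of_le ?_ ?_
  · rw [norm_mul, S.norm_p]
    gcongr
    exact le_max_left _ _
  · rw [norm_mul]
    gcongr
    exact le_max_right _ _

lemma mapsTo_relaxation (S : IsSmallPerturbation p r q G) (hl : ‖lam - 1‖ < 1) :
    Set.MapsTo (relaxation p G lam) (closedBall 1 (‖G 1‖ / p)) (closedBall 1 (‖G 1‖ / p)) := by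
  intro z hz
  rw [mem_closedBall, dist_eq_norm] at hz ⊢
  refine norm_sub_le_trans (y := relaxation p G lam 1) ?_ S.norm_relaxation_one_sub.le
  refine (S.norm_relaxation_sub_le hl (hz.trans S.norm_map_one_div_le) (by simp)).trans
    (le_trans ?_ hz)
  exact mul_le_of_le_one_left (norm_nonneg _) (max_le inv_lt_one.le hl.le)

/-- Existence is the contraction principle for `relaxation`. Uniqueness comes from the expansion:
the distance `d` of two fixed points satisfies `d = p d`. -/
lemma existsUnique_fixedPoint [CompleteSpace K] (S : IsSmallPerturbation p r q G)
    (hl : ‖lam - 1‖ < 1) : ∃! z, ‖z - 1‖ ≤ ‖G 1‖ / p ∧ perturb p G lam z = z := by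
  have hm := S.mapsTo_relaxation hl
  have hc : ContractingWith (max ⟨(p : ℝ)⁻¹, by positivity⟩ ‖lam - 1‖₊) (hm.restrict _ _ _) := by
    refine ⟨max_lt (NNReal.coe_lt_coe.1 inv_lt_one) (NNReal.coe_lt_coe.1 hl),
      LipschitzWith.of_dist_le_mul fun x y => ?_⟩
    have hx := x.2
    have hy := y.2
    rw [mem_closedBall, dist_eq_norm] at hx hy
    rw [Subtype.dist_eq, Subtype.dist_eq, dist_eq_norm, dist_eq_norm]
    exact S.norm_relaxation_sub_le hl (hx.trans S.norm_map_one_div_le)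
      (hy.trans S.norm_map_one_div_le)
  obtain ⟨z, hz, hfix, -⟩ := hc.exists_fixedPoint' isClosed_closedBall.isComplete hm
    (mem_closedBall_self (by positivity)) (edist_ne_top _ _)
  rw [mem_closedBall, dist_eq_norm] at hz
  refine ⟨z, ⟨hz, S.relaxation_eq_iff.1 hfix⟩, fun w ⟨hw, hwfix⟩ => ?_⟩
  have h := S.norm_perturb_sub_of_near_one hl
    ((hw.trans S.norm_map_one_div_le).trans_lt inv_lt_one)
    ((hz.trans S.norm_map_one_div_le).trans_lt inv_lt_one)
  rw [hwfix, S.relaxation_eq_iff.1 hfix] at h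
  have h2 := two_le_cast p
  rw [← sub_eq_zero, ← norm_eq_zero]
  nlinarith [norm_nonneg (w - z)]

lemma polyLimit_perturb (S : IsSmallPerturbation p r q G) {a : K} {R : ℝ} {g : K → K}
    (hg : IsPolyLimit (closedBall a R) g) (hr : ∀ lam ∈ closedBall a R, ‖g lam‖ ≤ r) :
    IsPolyLimit (closedBall a R) fun lam => perturb p G lam (g lam) := by
  have hid : IsPolyLimit (closedBall a R) fun lam => lam / (p : K) := by
    simpa [div_eq_mul_inv] using (IsPolyLimit.id a R).mul (.const (p : K)⁻¹)
  exact ((hid.mul (hg.pow p)).add (((IsPolyLimit.const 1).sub hid).mul (hg.pow (p + 1)))).add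
    (S.polyLimit.comp hg fun lam hlam => by simpa using hr lam hlam)

/-- Needed to find small values of `λ ↦ f_λ^n(x) - h(λ)`. The iterates of `relaxation` from `1`
converge to `h` at the rate `θ^n`, uniformly on the ball. -/
lemma polyLimit_fixedPoint (S : IsSmallPerturbation p r q G) {a : K} {R : ℝ} {h : K → K}
    (ha : ‖a - 1‖ < 1) (hR : R < 1)
    (hh : ∀ lam, ‖lam - 1‖ < 1 → ‖h lam - 1‖ ≤ ‖G 1‖ / p ∧ perturb p G lam (h lam) = h lam) :
    IsPolyLimit (closedBall a R) h := by
  have hball : ∀ lam ∈ closedBall a R, ‖lam - 1‖ ≤ max R ‖a - 1‖ := fun lam hlam => by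
    rw [mem_closedBall, dist_eq_norm] at hlam
    exact norm_sub_le_trans (hlam.trans (le_max_left _ _)) (le_max_right _ _)
  have hball' : ∀ lam ∈ closedBall a R, ‖lam - 1‖ < 1 := fun lam hlam =>
    (hball lam hlam).trans_lt (max_lt hR ha)
  set θ : ℝ := max (p : ℝ)⁻¹ (max R ‖a - 1‖)
  have hθ0 : 0 ≤ θ := le_max_of_le_left (by positivity)
  have hθ1 : θ < 1 := max_lt inv_lt_one (max_lt hR ha)
  have hmem : ∀ n, ∀ lam ∈ closedBall a R,
      ‖(relaxation p G lam)^[n] 1 - 1‖ ≤ ‖G 1‖ / p := fun n lam hlam => by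
    simpa [dist_eq_norm] using (S.mapsTo_relaxation (hball' lam hlam)).iterate n
      (mem_closedBall_self (x := (1 : K)) (by positivity))
  refine .of_uniform fun η hη => ?_
  obtain ⟨n, hn⟩ := exists_pow_lt_of_lt_one hη hθ1
  refine ⟨fun lam => (relaxation p G lam)^[n] 1, ?_, fun lam hlam => ?_⟩
  · clear hn
    induction n with
    | zero => exact .const 1
    | succ n ih =>
      simp only [Function.iterate_succ_apply']
      refine ih.add ((IsPolyLimit.const _).mul ((S.polyLimit_perturb ih fun lam hlam => ?_).sub ih))
      have := hmem n lam hlam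
      rw [norm_eq_one_of_norm_sub_one_lt ((this.trans S.norm_map_one_div_le).trans_lt inv_lt_one)]
      exact S.one_lt.le
  · obtain ⟨hh1, hh2⟩ := hh lam (hball' lam hlam)
    refine le_trans ?_ hn.le
    clear hn
    dsimp only
    induction n with
    | zero => simpa [norm_sub_rev] using hh1.trans (S.norm_map_one_div_le.trans inv_lt_one.le)
    | succ n ih =>
      rw [norm_sub_rev] at ih ⊢
      rw [Function.iterate_succ_apply', ← S.relaxation_eq_iff.2 hh2, pow_succ']
      refine (S.norm_relaxation_sub_le (hball' lam hlam)
        ((hmem n lam hlam).trans S.norm_map_one_div_le)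
        (hh1.trans S.norm_map_one_div_le)).trans ?_
      exact mul_le_mul (max_le_max le_rfl (hball lam hlam)) ih (norm_nonneg _) hθ0

end IsSmallPerturbation

/-! ### Orbits as functions of the parameter. -/

/-- The `n`-th point of the orbit of `x` under `perturb p G lam`, as a function of `lam`. -/
def orbitPt (p : ℕ) {K : Type*} [NontriviallyNormedField K] (G : K → K) (x : K) (n : ℕ)
    (lam : K) : K :=
  (perturb p G lam)^[n] x

lemma orbitPt_succ (p : ℕ) {K : Type*} [NontriviallyNormedField K] (G : K → K) (x : K) (n : ℕ)
    (lam : K) : orbitPt p G x (n + 1) lam = perturb p G lam (orbitPt p G x n lam) :=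
  Function.iterate_succ_apply' _ _ _

/-- On the closed ball of center `a` and radius `R` the function `lam ↦ orbitPt p G x n lam` is
analytic, bounded by `r`, and multiplies all distances by `C`. -/
structure IsDilating (p : ℕ) {K : Type*} [NontriviallyNormedField K] (G : K → K) (r : ℝ) (x : K)
    (n : ℕ) (a : K) (R C : ℝ) : Prop where
  polyLimit : IsPolyLimit (closedBall a R) (orbitPt p G x n)
  norm_le : ∀ lam ∈ closedBall a R, ‖orbitPt p G x n lam‖ ≤ r
  norm_sub : ∀ lam ∈ closedBall a R, ∀ mu ∈ closedBall a R,
    ‖orbitPt p G x n lam - orbitPt p G x n mu‖ = C * ‖lam - mu‖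

lemma IsDilating.recenter {p : ℕ} {K : Type*} [NontriviallyNormedField K]
    {G : K → K} {r : ℝ} {x : K} {n : ℕ} {a b : K} {R C : ℝ}
    (D : IsDilating p G r x n a R C) (h : closedBall b R = closedBall a R) :
    IsDilating p G r x n b R C where
  polyLimit := by rw [h]; exact D.polyLimit
  norm_le := by rw [h]; exact D.norm_le
  norm_sub := by rw [h]; exact D.norm_sub

namespace IsSmallPerturbation

variable {p : ℕ} [Fact p.Prime] {K : Type*} [NontriviallyNormedField K] [IsUltrametricDist K]
  {r q : ℝ} {G : K → K} {lam mu z w : K}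

/-- The dynamics contributes exactly `p C |λ - μ|`, and the explicit dependence on the parameter
contributes `p |λ - μ| |w - 1|`, strictly less since `|w - 1| < 1 ≤ C`. -/
lemma isDilating_succ (S : IsSmallPerturbation p r q G) {x : K} {n : ℕ} {a : K} {R C : ℝ}
    (hC : 1 ≤ C) (hl : ∀ lam ∈ closedBall a R, ‖lam - 1‖ < 1)
    (D : IsDilating p G r x n a R C)
    (hnear : ∀ lam ∈ closedBall a R, ‖orbitPt p G x n lam - 1‖ < 1)
    (hr : ∀ lam ∈ closedBall a R, ‖orbitPt p G x (n + 1) lam‖ ≤ r) :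
    IsDilating p G r x (n + 1) a R (p * C) where
  polyLimit := by
    simpa only [← orbitPt_succ] using S.polyLimit_perturb D.polyLimit D.norm_le
  norm_le := hr
  norm_sub lam hlam mu hmu := by
    rcases eq_or_ne lam mu with rfl | hne
    · simp
    have hpos : 0 < ‖lam - mu‖ := norm_pos_iff.2 (sub_ne_zero.2 hne)
    have h1 := S.norm_perturb_sub_of_near_one (hl lam hlam) (hnear lam hlam) (hnear mu hmu)
    rw [D.norm_sub lam hlam mu hmu, ← mul_assoc] at h1
    rw [orbitPt_succ, orbitPt_succ, ← h1, ← sub_add_sub_cancel _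
      (perturb p G lam (orbitPt p G x n mu)), add_comm]
    refine norm_add_eq_of_lt ?_
    rw [h1, S.perturb_sub_perturb_param, norm_mul, norm_mul, norm_div, S.norm_p, norm_pow,
      norm_eq_one_of_norm_sub_one_lt (hnear mu hmu), one_pow, one_mul, norm_sub_rev 1]
    have := hnear mu hmu
    have hp := cast_pos' p
    calc ‖lam - mu‖ / (p : ℝ)⁻¹ * ‖orbitPt p G x n mu - 1‖ < ‖lam - mu‖ / (p : ℝ)⁻¹ * 1 := by
          gcongr
      _ = p * 1 * ‖lam - mu‖ := by field_simp
      _ ≤ p * C * ‖lam - mu‖ := by gcongr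

end IsSmallPerturbation

/-! ### Passage near the repelling fixed point. -/

/-- `h lam` is a fixed point of `perturb p G lam` close to `1`, for all `lam` in the parameter
disc. -/
def IsFixedPointFamily (p : ℕ) {K : Type*} [NontriviallyNormedField K] (G h : K → K) : Prop :=
  ∀ lam, ‖lam - 1‖ < 1 → ‖h lam - 1‖ ≤ ‖G 1‖ / p ∧ perturb p G lam (h lam) = h lam

namespace IsSmallPerturbation

variable {p : ℕ} [Fact p.Prime] {K : Type*} [NontriviallyNormedField K]
  {r q : ℝ} {G h : K → K} {lam mu z w x a c : K} {n k M : ℕ}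

lemma norm_fixedPoint_sub_one (S : IsSmallPerturbation p r q G) (hh : IsFixedPointFamily p G h)
    (hl : ‖lam - 1‖ < 1) : ‖h lam - 1‖ < 1 :=
  ((hh lam hl).1.trans S.norm_map_one_div_le).trans_lt inv_lt_one

/-- Backward orbit of the radius `|c|` under `s ↦ p s^p`. Radii are carried by elements of `K` so
that they are attained as norms. -/
lemma exists_radii [IsAlgClosed K] (S : IsSmallPerturbation p r q G) (c : K) :
    ∃ e : ℕ → K, e 0 = c ∧ ∀ j, p * ‖e (j + 1)‖ ^ p = ‖e j‖ := by
  have hroot : ∀ y : K, ∃ z : K, z ^ p = p * y := fun y =>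
    IsAlgClosed.exists_pow_nat_eq _ (Fact.out : p.Prime).pos
  choose f hf using hroot
  refine ⟨fun j => f^[j] c, rfl, fun j => ?_⟩
  simp only [Function.iterate_succ_apply']
  rw [← norm_pow, hf, norm_mul, S.norm_p, ← mul_assoc, mul_inv_cancel₀ (cast_pos' p).ne', one_mul]

lemma rho_lt_norm_of_radii {e : ℕ → K} (h0 : 1 < ‖e 0‖)
    (he : ∀ j, p * ‖e (j + 1)‖ ^ p = ‖e j‖) (j : ℕ) : rho p < ‖e j‖ := by
  induction j with
  | zero => exact (rho_lt_one p).trans h0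
  | succ j ih =>
    by_contra! hle
    have := mul_pow_le_mul_pow (p := p) (norm_nonneg _) hle
    rw [he, mul_rho_pow] at this
    linarith

lemma norm_lt_one_of_radii {e : ℕ → K} (h0 : ‖e 0‖ < p)
    (he : ∀ j, p * ‖e (j + 1)‖ ^ p = ‖e j‖) (j : ℕ) : ‖e (j + 1)‖ < 1 := by
  have hstep : ∀ i, ‖e i‖ < p → ‖e (i + 1)‖ < 1 := fun i hlt => by
    by_contra! hle
    have := mul_pow_le_mul_pow (p := p) one_pos.le hle
    rw [he, one_pow] at this
    linarith
  induction j with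
  | zero => exact hstep 0 h0
  | succ j ih => exact hstep _ (by linarith [two_le_cast p])

variable [IsUltrametricDist K]

lemma norm_sub_one_lt_of_mem {R : ℝ} (ha : ‖a - 1‖ < 1) (hR : R < 1) (hl : lam ∈ closedBall a R) :
    ‖lam - 1‖ < 1 := by
  rw [mem_closedBall, dist_eq_norm] at hl
  simpa using norm_add_lt_of_lt (hl.trans_lt hR) ha

/-- Since `|c| < p`, the image disc at times `j < M` has radius at most `p^j |c| / p^M < 1`, so it
stays in `|z - 1| < 1`. Only at time `M` does it reach radius `|c|`. -/
lemma isDilating_near_fixedPoint (S : IsSmallPerturbation p r q G)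
    (hh : IsFixedPointFamily p G h) (hcp : ‖c‖ < p) (hcr : ‖c‖ ≤ r) (ha : ‖a - 1‖ < 1)
    (hR : ‖c‖ / p ^ M < 1) (D : IsDilating p G r x n a (‖c‖ / p ^ M) 1)
    (hη : ‖orbitPt p G x n a - h a‖ < ((p : ℝ) ^ M)⁻¹) :
    ∀ j ≤ M, IsDilating p G r x (n + j) a (‖c‖ / p ^ M) (p ^ j) ∧
      ‖orbitPt p G x (n + j) a - h a‖ < p ^ j * ((p : ℝ) ^ M)⁻¹ ∧
      (j < M → ∀ lam ∈ closedBall a (‖c‖ / p ^ M), ‖orbitPt p G x (n + j) lam - 1‖ < 1) := by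
  have hp := cast_pos' p
  have h2 := two_le_cast p
  have hball : ∀ lam ∈ closedBall a (‖c‖ / p ^ M), ‖lam - 1‖ < 1 := fun lam hl =>
    norm_sub_one_lt_of_mem ha hR hl
  have haE : a ∈ closedBall a (‖c‖ / p ^ M) := mem_closedBall_self (by positivity)
  have hnear : ∀ j < M, IsDilating p G r x (n + j) a (‖c‖ / p ^ M) (p ^ j) →
      ‖orbitPt p G x (n + j) a - h a‖ < p ^ j * ((p : ℝ) ^ M)⁻¹ →
      ∀ lam ∈ closedBall a (‖c‖ / p ^ M), ‖orbitPt p G x (n + j) lam - 1‖ < 1 := by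
    intro j hj Dj hηj lam hlam
    have hpj : (p : ℝ) ^ (j + 1) ≤ p ^ M := pow_le_pow_right₀ (by linarith) hj
    have h1 : ‖orbitPt p G x (n + j) lam - orbitPt p G x (n + j) a‖ < 1 := by
      rw [Dj.norm_sub lam hlam a haE]
      rw [mem_closedBall, dist_eq_norm] at hlam
      calc (p : ℝ) ^ j * ‖lam - a‖ ≤ p ^ j * (‖c‖ / p ^ M) := by gcongr
        _ < p ^ j * (p / p ^ M) := by gcongr
        _ = p ^ (j + 1) / p ^ M := by ring
        _ ≤ 1 := div_le_one_of_le₀ hpj (by positivity)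
    have h2 : ‖orbitPt p G x (n + j) a - h a‖ < 1 := by
      refine hηj.trans_le ?_
      rw [← div_eq_mul_inv]
      exact div_le_one_of_le₀ (pow_le_pow_right₀ (by linarith) hj.le) (by positivity)
    simpa using norm_add_lt_of_lt (norm_add_lt_of_lt h1 h2) (S.norm_fixedPoint_sub_one hh ha)
  suffices hmain : ∀ j ≤ M, IsDilating p G r x (n + j) a (‖c‖ / p ^ M) (p ^ j) ∧
      ‖orbitPt p G x (n + j) a - h a‖ < p ^ j * ((p : ℝ) ^ M)⁻¹ from fun j hj =>
    ⟨(hmain j hj).1, (hmain j hj).2, fun hj' => hnear j hj' (hmain j hj).1 (hmain j hj).2⟩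
  intro j
  induction j with
  | zero => exact fun _ => ⟨by simpa using D, by simpa using hη⟩
  | succ j ih =>
    intro hj
    obtain ⟨Dj, hηj⟩ := ih (by omega)
    have hn := hnear j hj Dj hηj
    have hη' : ‖orbitPt p G x (n + (j + 1)) a - h a‖ < p ^ (j + 1) * ((p : ℝ) ^ M)⁻¹ := by
      rw [← (hh a ha).2, ← add_assoc, orbitPt_succ,
        S.norm_perturb_sub_of_near_one ha (hn a haE) (S.norm_fixedPoint_sub_one hh ha), pow_succ',
        mul_assoc]
      gcongr
    refine ⟨?_, hη'⟩
    rw [pow_succ', ← add_assoc]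
    refine S.isDilating_succ (one_le_pow₀ (by linarith)) hball Dj hn fun lam hlam => ?_
    have hη1 : ‖orbitPt p G x (n + (j + 1)) a - h a‖ ≤ 1 := by
      refine hη'.le.trans ?_
      rw [← div_eq_mul_inv]
      exact div_le_one_of_le₀ (pow_le_pow_right₀ (by linarith) hj) (by positivity)
    have hha : ‖h a‖ = 1 := norm_eq_one_of_norm_sub_one_lt (S.norm_fixedPoint_sub_one hh ha)
    have h1 : ‖orbitPt p G x (n + (j + 1)) a‖ ≤ r := by
      simpa using norm_add_le_of_le (hη1.trans S.one_lt.le) (hha.le.trans S.one_lt.le)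
    have h3 : ‖orbitPt p G x (n + j + 1) lam - orbitPt p G x (n + (j + 1)) a‖ ≤ r := by
      rw [← add_assoc, orbitPt_succ, orbitPt_succ]
      have e : perturb p G lam (orbitPt p G x (n + j) lam) -
          perturb p G a (orbitPt p G x (n + j) a) =
          (perturb p G lam (orbitPt p G x (n + j) lam) -
            perturb p G lam (orbitPt p G x (n + j) a)) +
          (lam - a) / p * (orbitPt p G x (n + j) a ^ p * (1 - orbitPt p G x (n + j) a)) := by
        rw [← S.perturb_sub_perturb_param]; ring
      have hlam' := hlam
      rw [mem_closedBall, dist_eq_norm] at hlam'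
      have hbound : p * (‖c‖ / p ^ M) ≤ ‖c‖ := by
        have : (p : ℝ) ^ 1 ≤ p ^ M := pow_le_pow_right₀ (by linarith) (by omega)
        rw [mul_div_assoc', div_le_iff₀ (by positivity), mul_comm]
        gcongr
        simpa using this
      rw [e]
      refine norm_add_le_of_le ?_ ?_
      · rw [S.norm_perturb_sub_of_near_one (hball lam hlam) (hn lam hlam) (hn a haE),
          Dj.norm_sub lam hlam a haE, ← mul_assoc, ← pow_succ']
        refine le_trans ?_ hcr
        calc (p : ℝ) ^ (j + 1) * ‖lam - a‖ ≤ p ^ M * (‖c‖ / p ^ M) := by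
              gcongr
              · linarith
          _ = ‖c‖ := by field_simp
      · rw [norm_mul, norm_mul, norm_div, S.norm_p, norm_pow,
          norm_eq_one_of_norm_sub_one_lt (hn a haE), one_pow, one_mul, norm_sub_rev 1]
        refine le_trans ?_ (hbound.trans hcr)
        rw [div_inv_eq_mul, mul_comm ‖lam - a‖, mul_assoc]
        gcongr
        exact (mul_le_of_le_one_right (norm_nonneg _) (hn a haE).le).trans hlam'
    simpa using norm_add_le_of_le h3 h1

/-- At time `M` the orbit has norm `1` for the parameter `a` and norm `|c| > 1` for `a + c p^M`. The
norm is not constant, so some parameter brings the orbit below `ρ`. -/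
lemma exists_isDilating_center [IsAlgClosed K] (S : IsSmallPerturbation p r q G)
    (hh : IsFixedPointFamily p G h) (hc1 : 1 < ‖c‖) (hcp : ‖c‖ < p) (hcr : ‖c‖ ≤ r)
    (ha : ‖a - 1‖ < 1) (hR : ‖c‖ / p ^ M < 1)
    (D : IsDilating p G r x n a (‖c‖ / p ^ M) 1)
    (hη : ‖orbitPt p G x n a - h a‖ < ((p : ℝ) ^ M)⁻¹) :
    ∃ b, closedBall b (‖c‖ / p ^ M) = closedBall a (‖c‖ / p ^ M) ∧ ‖b - 1‖ < 1 ∧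
      IsDilating p G r x (n + M) b (‖c‖ / p ^ M) (p ^ M) ∧
      ‖orbitPt p G x (n + M) b‖ < rho p ∧
      ∀ lam ∈ closedBall b (‖c‖ / p ^ M), ∀ j < M, ‖orbitPt p G x (n + j) lam - 1‖ < 1 := by
  have hp := cast_pos' p
  have key := S.isDilating_near_fixedPoint hh hcp hcr ha hR D hη
  obtain ⟨DM, hηM, -⟩ := key M le_rfl
  have haE : a ∈ closedBall a (‖c‖ / p ^ M) := mem_closedBall_self (by positivity)
  have hbE : a + c * p ^ M ∈ closedBall a (‖c‖ / p ^ M) := by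
    rw [mem_closedBall, dist_eq_norm, add_sub_cancel_left, norm_mul, norm_pow, S.norm_p, inv_pow,
      div_eq_mul_inv]
  have hna : ‖orbitPt p G x (n + M) a‖ = 1 := by
    rw [mul_inv_cancel₀ (by positivity)] at hηM
    have hha : ‖h a‖ = 1 := norm_eq_one_of_norm_sub_one_lt (S.norm_fixedPoint_sub_one hh ha)
    rw [← hha]
    exact norm_eq_of_norm_sub_lt (by rwa [hha])
  have hnb : ‖orbitPt p G x (n + M) (a + c * p ^ M)‖ = ‖c‖ := by
    have h1 := DM.norm_sub _ hbE a haE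
    rw [add_sub_cancel_left, norm_mul, norm_pow, S.norm_p, inv_pow, mul_left_comm,
      mul_inv_cancel₀ (by positivity), mul_one] at h1
    have h2 := norm_add_eq_of_lt (x := orbitPt p G x (n + M) a)
      (y := orbitPt p G x (n + M) (a + c * p ^ M) - orbitPt p G x (n + M) a) (by rwa [h1, hna])
    rwa [add_sub_cancel, h1] at h2
  obtain ⟨b, hb, hb0⟩ := DM.polyLimit.exists_norm_lt haE hbE (by rw [hna, hnb]; exact hc1.ne)
    (rho_pos p)
  have hball := IsUltrametricDist.closedBall_eq_of_mem hb
  refine ⟨b, hball.symm, norm_sub_one_lt_of_mem ha hR hb, IsDilating.recenter DM hball.symm, hb0,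
    fun lam hlam j hj => (key j hj.le).2.2 hj lam (by rwa [hball])⟩

lemma norm_perturb_sub_perturb_le (S : IsSmallPerturbation p r q G) (hl : ‖lam - 1‖ < 1)
    (hw1 : ‖w‖ < 1) (hw' : p * ‖w‖ ^ p ≤ 1) (hd : ‖z - w‖ ≤ ((p : ℝ) ^ 2)⁻¹) :
    ‖perturb p G lam z - perturb p G mu w‖ ≤
      max (max (kappa p) (p * ‖w‖ ^ p) * ‖z - w‖) (‖lam - mu‖ * (p * ‖w‖ ^ p)) := by
  rw [← sub_add_sub_cancel _ (perturb p G lam w)]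
  exact norm_add_le_of_le
    ((S.norm_perturb_sub_le_max hl hw1 hw' hd).trans (le_max_left _ _))
    ((S.norm_perturb_sub_param hw1).le.trans (le_max_right _ _))

end IsSmallPerturbation

/-! ### Passage through the annulus. -/

namespace IsSmallPerturbation

variable {p : ℕ} [Fact p.Prime] {K : Type*} [NontriviallyNormedField K]
  {r q : ℝ} {G h : K → K} {lam mu z w x a b c : K} {n k m M : ℕ}

variable [IsUltrametricDist K]

/-- An orbit which starts in the annulus `|z| ≤ ‖e m‖` and follows the radii `e`. -/
lemma norm_orbitPt_le_radii (S : IsSmallPerturbation p r q G) (hl : ‖lam - 1‖ < 1) {e : ℕ → K}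
    (h0 : 1 < ‖e 0‖) (h0p : ‖e 0‖ < p) (he : ∀ j, p * ‖e (j + 1)‖ ^ p = ‖e j‖)
    (hn : ‖orbitPt p G x n lam‖ ≤ ‖e m‖) (j i : ℕ) (hij : j + i = m) :
    ‖orbitPt p G x (n + j) lam‖ ≤ ‖e i‖ := by
  induction j generalizing i with
  | zero => rw [zero_add] at hij; subst hij; exact hn
  | succ j ih =>
    have hj := ih (i + 1) (by omega)
    rw [← add_assoc, orbitPt_succ]
    refine (S.norm_perturb_le hl (hj.trans_lt (norm_lt_one_of_radii h0p he i))).trans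
      (max_le (S.lt_rho.trans (rho_lt_norm_of_radii h0 he i)).le ?_)
    rw [← he i]
    exact mul_pow_le_mul_pow (norm_nonneg _) hj

lemma norm_orbitPt_eq_radii (S : IsSmallPerturbation p r q G) (hl : ‖lam - 1‖ < 1) {e : ℕ → K}
    (h0 : 1 < ‖e 0‖) (h0p : ‖e 0‖ < p) (he : ∀ j, p * ‖e (j + 1)‖ ^ p = ‖e j‖)
    (hn : ‖orbitPt p G x n lam‖ = ‖e m‖) (j i : ℕ) (hij : j + i = m) :
    ‖orbitPt p G x (n + j) lam‖ = ‖e i‖ := by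
  induction j generalizing i with
  | zero => rw [zero_add] at hij; subst hij; exact hn
  | succ j ih =>
    have hj := ih (i + 1) (by omega)
    have := rho_lt_norm_of_radii h0 he (i + 1)
    have := norm_lt_one_of_radii h0p he i
    rw [← add_assoc, orbitPt_succ, S.norm_perturb_of_rho_lt hl (by rwa [hj]) (by rwa [hj]), hj, he]

lemma norm_orbitPt_le_rho (S : IsSmallPerturbation p r q G) (hl : ‖lam - 1‖ < 1)
    (hn : ‖orbitPt p G x n lam‖ ≤ rho p) (j : ℕ) : ‖orbitPt p G x (n + j) lam‖ ≤ rho p := by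
  induction j with
  | zero => exact hn
  | succ j ih => exact (orbitPt_succ p G x (n + j) lam) ▸ S.norm_perturb_le_rho hl ih

/-- Some parameter in a dilating disc sends the orbit, along the annulus `ρ < |z| < 1`, very close
to the repelling fixed point. -/
lemma exists_orbitPt_near_fixedPoint [IsAlgClosed K] (S : IsSmallPerturbation p r q G)
    (hh : IsFixedPointFamily p G h) {e : ℕ → K} (h0 : 1 < ‖e 0‖) (h0p : ‖e 0‖ < p)
    (h0r : ‖e 0‖ ≤ r) (he : ∀ j, p * ‖e (j + 1)‖ ^ p = ‖e j‖) (ha : ‖a - 1‖ < 1) {C : ℝ}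
    (hC : 0 < C) (hCv : ∃ y : K, ‖y‖ = C⁻¹) (hR : ‖e m‖ / C < 1)
    (D : IsDilating p G r x n a (‖e m‖ / C) C)
    (hρ : ‖orbitPt p G x n a‖ < rho p) {η : ℝ} (hη : 0 < η) (hη1 : η < 1) :
    (∀ j ≤ m, IsPolyLimit (closedBall a (‖e m‖ / C)) (orbitPt p G x (n + j)) ∧
      ∀ lam ∈ closedBall a (‖e m‖ / C), ‖orbitPt p G x (n + j) lam‖ ≤ r) ∧
    ∃ b ∈ closedBall a (‖e m‖ / C), ‖orbitPt p G x (n + m) b - h b‖ < η ∧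
      ‖orbitPt p G x (n + m) b‖ = 1 ∧
      ∀ j < m, rho p < ‖orbitPt p G x (n + j) b‖ ∧ ‖orbitPt p G x (n + j) b‖ < 1 := by
  have hball : ∀ lam ∈ closedBall a (‖e m‖ / C), ‖lam - 1‖ < 1 := fun lam hl =>
    norm_sub_one_lt_of_mem ha hR hl
  have haE : a ∈ closedBall a (‖e m‖ / C) := mem_closedBall_self (by positivity)
  have hle : ∀ lam ∈ closedBall a (‖e m‖ / C), ∀ j i, j + i = m →
      ‖orbitPt p G x (n + j) lam‖ ≤ ‖e i‖ := fun lam hlam =>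
    S.norm_orbitPt_le_radii (hball lam hlam) h0 h0p he (by
      have h1 := D.norm_sub lam hlam a haE
      rw [mem_closedBall, dist_eq_norm, le_div_iff₀ hC, mul_comm, ← h1] at hlam
      simpa using norm_add_le_of_le hlam (hρ.trans (rho_lt_norm_of_radii h0 he m)).le)
  have her : ∀ i, ‖e i‖ ≤ r := fun i => by
    cases i with
    | zero => exact h0r
    | succ i => exact ((norm_lt_one_of_radii h0p he i).trans S.one_lt).le
  have hler : ∀ j ≤ m, ∀ lam ∈ closedBall a (‖e m‖ / C), ‖orbitPt p G x (n + j) lam‖ ≤ r :=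
    fun j hj lam hlam => (hle lam hlam j (m - j) (by omega)).trans (her _)
  have hpoly : ∀ j ≤ m, IsPolyLimit (closedBall a (‖e m‖ / C)) (orbitPt p G x (n + j)) := by
    intro j
    induction j with
    | zero => exact fun _ => D.polyLimit
    | succ j ih =>
      intro hj
      have := S.polyLimit_perturb (ih (by omega)) (hler j (by omega))
      simp only [← orbitPt_succ] at this
      exact this
  refine ⟨fun j hj => ⟨hpoly j hj, hler j hj⟩, ?_⟩
  have hh1 : ∀ lam ∈ closedBall a (‖e m‖ / C), ‖h lam‖ = 1 := fun lam hlam =>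
    norm_eq_one_of_norm_sub_one_lt (S.norm_fixedPoint_sub_one hh (hball lam hlam))
  obtain ⟨y, hy⟩ := hCv
  have hem : 0 < ‖e m‖ := (rho_pos p).trans (rho_lt_norm_of_radii h0 he m)
  have hbE : a + e m * y ∈ closedBall a (‖e m‖ / C) := by
    rw [mem_closedBall, dist_eq_norm, add_sub_cancel_left, norm_mul, hy, div_eq_mul_inv]
  -- Two parameters with different norms: at `a` the orbit is trapped in `|z| ≤ ρ`; at the boundary
  -- point `a + e m * y` it has norm `‖e m‖` at time `n`, hence follows the radii up to `‖e 0‖ > 1`.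
  have hna : ‖orbitPt p G x (n + m) a - h a‖ = 1 := by
    have h1 := (S.norm_orbitPt_le_rho ha hρ.le m).trans_lt (rho_lt_one p)
    rw [sub_eq_add_neg, norm_add_eq_of_lt, norm_neg, hh1 a haE]
    rwa [norm_neg, hh1 a haE]
  have hnb : ‖orbitPt p G x (n + m) (a + e m * y) - h (a + e m * y)‖ = ‖e 0‖ := by
    have h1 := D.norm_sub _ hbE a haE
    rw [add_sub_cancel_left, norm_mul, hy, mul_left_comm, mul_inv_cancel₀ hC.ne', mul_one] at h1
    have h2 := norm_add_eq_of_lt (x := orbitPt p G x n a)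
      (y := orbitPt p G x n (a + e m * y) - orbitPt p G x n a)
      (by rw [h1]; exact hρ.trans (rho_lt_norm_of_radii h0 he m))
    rw [add_sub_cancel, h1] at h2
    have h3 := S.norm_orbitPt_eq_radii (hball _ hbE) h0 h0p he h2 m 0 (by omega)
    rw [← h3]
    have h4 := norm_add_eq_of_lt (x := -h (a + e m * y))
      (y := orbitPt p G x (n + m) (a + e m * y)) (by rwa [norm_neg, hh1 _ hbE, h3])
    rwa [neg_add_eq_sub] at h4
  obtain ⟨b, hb, hbη⟩ := ((hpoly m le_rfl).sub (S.polyLimit_fixedPoint ha hR hh)).exists_norm_lt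
    haE hbE (by rw [hna, hnb]; exact h0.ne) hη
  have hb1 : ‖orbitPt p G x (n + m) b‖ = 1 := by
    rw [← hh1 b hb]
    exact norm_eq_of_norm_sub_lt (by rw [hh1 b hb]; exact hbη.trans hη1)
  refine ⟨b, hb, hbη, hb1, fun j hj => ⟨?_, ?_⟩⟩
  -- Below `ρ` the orbit would be trapped and could not have norm `1` at time `n + m`.
  · by_contra! hlt
    have h1 := S.norm_orbitPt_le_rho (hball b hb) hlt (m - j)
    rw [show n + j + (m - j) = n + m by omega, hb1] at h1
    linarith [rho_lt_one p]
  · exact (hle b hb j (m - j - 1 + 1) (by omega)).trans_lt (norm_lt_one_of_radii h0p he _)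

/-- Passage along the annulus `ρ < |z| < 1` erases the dependence of the initial point on the
parameter. -/
lemma norm_orbitPt_sub_of_annulus (S : IsSmallPerturbation p r q G) (hb : ‖b - 1‖ < 1) {C R : ℝ}
    (hC : 1 ≤ C) (hR : R * C ≤ ((p : ℝ) ^ 2)⁻¹) (hR1 : R < 1)
    (hm : kappa p ^ m * C ≤ kappa p)
    (D : ∀ lam ∈ closedBall b R, ∀ mu ∈ closedBall b R,
      ‖orbitPt p G x n lam - orbitPt p G x n mu‖ = C * ‖lam - mu‖)
    (h1 : ‖orbitPt p G x (n + (m + 1)) b‖ = 1)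
    (hann : ∀ j < m + 1, rho p < ‖orbitPt p G x (n + j) b‖ ∧ ‖orbitPt p G x (n + j) b‖ < 1) :
    (∀ lam ∈ closedBall b R, ∀ j < m + 1,
      rho p < ‖orbitPt p G x (n + j) lam‖ ∧ ‖orbitPt p G x (n + j) lam‖ < 1) ∧
    ∀ lam ∈ closedBall b R, ∀ mu ∈ closedBall b R,
      ‖orbitPt p G x (n + (m + 1)) lam - orbitPt p G x (n + (m + 1)) mu‖ = ‖lam - mu‖ := by
  have hk0 := kappa_pos p
  have hk1 := kappa_lt_one p
  have hball : ∀ lam ∈ closedBall b R, ‖lam - 1‖ < 1 := fun lam hl =>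
    norm_sub_one_lt_of_mem hb hR1 hl
  have hrec : ∀ j < m + 1, p * ‖orbitPt p G x (n + j) b‖ ^ p =
      ‖orbitPt p G x (n + (j + 1)) b‖ := fun j hj => by
    rw [← add_assoc, orbitPt_succ, S.norm_perturb_of_rho_lt hb (hann j hj).1 (hann j hj).2]
  have hle1 : ∀ j ≤ m + 1, ‖orbitPt p G x (n + j) b‖ ≤ 1 := fun j hj => by
    rcases hj.lt_or_eq with hj | rfl
    · exact (hann j hj).2.le
    · exact h1.le
  have hlek : ∀ j < m + 1, ‖orbitPt p G x (n + j) b‖ ≤ kappa p := fun j hj =>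
    le_kappa_of_mul_pow_le_one (by rw [hrec j hj]; exact hle1 (j + 1) hj)
  have hsmall : ∀ j, ∀ lam ∈ closedBall b R, ∀ mu ∈ closedBall b R,
      ‖orbitPt p G x (n + j) lam - orbitPt p G x (n + j) mu‖ ≤
        max (kappa p ^ j * C) (kappa p) * ‖lam - mu‖ →
      ‖orbitPt p G x (n + j) lam - orbitPt p G x (n + j) mu‖ ≤ ((p : ℝ) ^ 2)⁻¹ := by
    intro j lam hlam mu hmu hle
    have hd : ‖lam - mu‖ ≤ R := by
      rw [mem_closedBall, dist_eq_norm] at hlam hmu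
      exact norm_sub_le_trans hlam (by rwa [norm_sub_rev])
    have hmax : max (kappa p ^ j * C) (kappa p) ≤ C :=
      max_le (mul_le_of_le_one_left (by linarith) (pow_le_one₀ hk0.le hk1.le))
        (hk1.le.trans hC)
    refine hle.trans (le_trans ?_ hR)
    rw [mul_comm R]
    gcongr
  have heq : ∀ j ≤ m, (∀ lam ∈ closedBall b R, ∀ mu ∈ closedBall b R,
      ‖orbitPt p G x (n + j) lam - orbitPt p G x (n + j) mu‖ ≤
        max (kappa p ^ j * C) (kappa p) * ‖lam - mu‖) → ∀ mu ∈ closedBall b R,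
      ‖orbitPt p G x (n + j) mu‖ = ‖orbitPt p G x (n + j) b‖ := fun j hj H mu hmu => by
    have hbR : b ∈ closedBall b R :=
      mem_closedBall_self (by rw [mem_closedBall] at hmu; exact dist_nonneg.trans hmu)
    exact norm_eq_of_sub (p := p) (hann j (by omega)).1 (hsmall j mu hmu b hbR (H mu hmu b hbR))
  -- Before the last step all images have norm at most `κ`: the previous difference is multiplied by
  -- at most `κ`, and the change of parameter adds at most `κ|λ - μ|`.
  have hmain : ∀ j ≤ m, ∀ lam ∈ closedBall b R, ∀ mu ∈ closedBall b R,
      ‖orbitPt p G x (n + j) lam - orbitPt p G x (n + j) mu‖ ≤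
        max (kappa p ^ j * C) (kappa p) * ‖lam - mu‖ := by
    intro j
    induction j with
    | zero =>
      intro _ lam hlam mu hmu
      rw [add_zero, D lam hlam mu hmu, pow_zero, one_mul]
      gcongr
      exact le_max_left _ _
    | succ j ih =>
      intro hj lam hlam mu hmu
      have ihj := ih (by omega)
      have hmub := heq j (by omega) ihj mu hmu
      have hnext := hlek (j + 1) (by omega)
      rw [← hrec j (by omega), ← hmub] at hnext
      have hstep := S.norm_perturb_sub_perturb_le (mu := mu) (hball lam hlam)
        (by rw [hmub]; exact (hann j (by omega)).2) (hnext.trans hk1.le)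
        (hsmall j lam hlam mu hmu (ihj lam hlam mu hmu))
      rw [← add_assoc, orbitPt_succ, orbitPt_succ]
      refine hstep.trans (max_le ?_ ?_)
      · rw [max_eq_left hnext]
        calc _ ≤ kappa p * (max (kappa p ^ j * C) (kappa p) * ‖lam - mu‖) := by
              gcongr; exact ihj lam hlam mu hmu
          _ ≤ _ := by
            rw [← mul_assoc, mul_max_of_nonneg _ _ hk0.le, ← mul_assoc, ← pow_succ']
            gcongr
            exact mul_le_of_le_one_left hk0.le hk1.le
      · rw [mul_comm]
        gcongr
        exact hnext.trans (le_max_right _ _)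
  refine ⟨fun lam hlam j hj => ?_, fun lam hlam mu hmu => ?_⟩
  · rw [heq j (by omega) (hmain j (by omega)) lam hlam]
    exact hann j hj
  · rcases eq_or_ne lam mu with rfl | hne
    · simp
    have hpos : 0 < ‖lam - mu‖ := norm_pos_iff.2 (sub_ne_zero.2 hne)
    have hd := hmain m le_rfl lam hlam mu hmu
    have hmub := heq m le_rfl (hmain m le_rfl) mu hmu
    have hd' := hsmall m lam hlam mu hmu hd
    rw [max_eq_right hm] at hd
    -- In the last step the change of parameter contributes exactly `|λ - μ|`, which dominates the
    -- inherited difference, at most `κ|λ - μ|`.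
    have hlast : p * ‖orbitPt p G x (n + m) mu‖ ^ p = 1 := by
      rw [hmub, hrec m (by omega), h1]
    have hmu1 : ‖orbitPt p G x (n + m) mu‖ < 1 := by rw [hmub]; exact (hann m (by omega)).2
    have hsec := S.norm_perturb_sub_param (lam := lam) (mu := mu) hmu1
    rw [hlast, mul_one] at hsec
    have hfst := S.norm_perturb_sub_le_max (hball lam hlam) hmu1 hlast.le hd'
    rw [hlast, max_eq_right hk1.le, one_mul] at hfst
    rw [← add_assoc, orbitPt_succ, orbitPt_succ,
      ← sub_add_sub_cancel _ (perturb p G lam (orbitPt p G x (n + m) mu)), ← hsec]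
    refine norm_add_eq_of_lt ?_
    rw [hsec]
    refine (hfst.trans hd).trans_lt ?_
    nlinarith

end IsSmallPerturbation

/-! ### One round: from one dilating parameter disc to a smaller one. -/

/-- The parameter disc of center `a` and radius `‖c‖ / p ^ k` is dilated onto a disc which meets
the attracting basin of `perturb p G lam` near `0`. -/
structure IsRoundStart (p : ℕ) [Fact p.Prime] {K : Type*} [NontriviallyNormedField K]
    (G : K → K) (r : ℝ) (c x : K) (n k : ℕ) (a : K) : Prop where
  dilating : IsDilating p G r x n a (‖c‖ / p ^ k) (p ^ k)
  norm_sub_one_lt : ‖a - 1‖ < 1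
  radius_lt_one : ‖c‖ / (p : ℝ) ^ k < 1
  norm_lt_rho : ‖orbitPt p G x n a‖ < rho p

lemma IsDilating.mono {p : ℕ} {K : Type*} [NontriviallyNormedField K] {G : K → K} {r : ℝ} {x : K}
    {n : ℕ} {a b : K} {R R' C : ℝ} (D : IsDilating p G r x n a R C)
    (hsub : closedBall b R' ⊆ closedBall a R) : IsDilating p G r x n b R' C where
  polyLimit := D.polyLimit.mono hsub
  norm_le lam hlam := D.norm_le lam (hsub hlam)
  norm_sub lam hlam mu hmu := D.norm_sub lam (hsub hlam) mu (hsub hmu)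

namespace IsSmallPerturbation

variable {p : ℕ} [Fact p.Prime] {K : Type*} [NontriviallyNormedField K]
  {r q : ℝ} {G h : K → K} {lam mu z w x a b c : K} {n k m M : ℕ}

variable [IsUltrametricDist K]

/-- The annulus passage turns the dilation `p^k` into an isometry, and `k + 3` steps near `1` give
the dilation `p^{k+3}`. The increment `3` makes the image of the new disc at time `n`, of radius
`|c|/p³`, fit into the scale `p⁻²`, because `|c| < p`. -/
lemma exists_round [IsAlgClosed K] (S : IsSmallPerturbation p r q G)
    (hh : IsFixedPointFamily p G h) (hc1 : 1 < ‖c‖) (hcp : ‖c‖ < p) (hcr : ‖c‖ ≤ r)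
    (I : IsRoundStart p G r c x n k a) (N : ℕ) :
    ∃ m ≥ N, ∃ b, IsRoundStart p G r c x (n + (m + 1) + (k + 3)) (k + 3) b ∧
      closedBall b (‖c‖ / p ^ (k + 3)) ⊆ closedBall a (‖c‖ / p ^ k) ∧
      kappa p ^ m * p ^ (k + 3) ≤ 1 ∧
      ∀ lam ∈ closedBall b (‖c‖ / p ^ (k + 3)),
        (∀ j < m + 1, rho p < ‖orbitPt p G x (n + j) lam‖ ∧ ‖orbitPt p G x (n + j) lam‖ < 1) ∧
        ∀ j < k + 3, ‖orbitPt p G x (n + (m + 1) + j) lam - 1‖ < 1 := by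
  have hp := cast_pos' p
  have h2 := two_le_cast p
  have hk0 := kappa_pos p
  have hk1 := kappa_lt_one p
  obtain ⟨e, he0, he⟩ := S.exists_radii c
  obtain ⟨m₀, hm₀⟩ := exists_pow_lt_of_lt_one (show 0 < ((p : ℝ) ^ (k + 3))⁻¹ by positivity) hk1
  set m := max N m₀
  have hmk : kappa p ^ m * p ^ (k + 3) ≤ 1 := by
    rw [← le_div_iff₀ (by positivity), one_div]
    exact (pow_le_pow_of_le_one hk0.le hk1.le (le_max_right _ _)).trans hm₀.le
  have hmk' : kappa p ^ m * p ^ k ≤ kappa p := by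
    refine le_trans ?_ (inv_le_kappa p)
    rw [← one_div, le_div_iff₀ hp, mul_assoc, ← pow_succ]
    refine le_trans ?_ hmk
    gcongr
    · linarith
    · omega
  have heρ := rho_lt_norm_of_radii (p := p) (by rwa [he0]) he (m + 1)
  have he1 := norm_lt_one_of_radii (p := p) (by rwa [he0]) he m
  have hsub : closedBall a (‖e (m + 1)‖ / p ^ k) ⊆ closedBall a (‖c‖ / p ^ k) :=
    closedBall_subset_closedBall (by gcongr; linarith)
  obtain ⟨hpoly, b, hb, hbη, hb1, hann⟩ := S.exists_orbitPt_near_fixedPoint (m := m + 1) hh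
    (by rwa [he0]) (by rwa [he0]) (by rwa [he0]) he I.norm_sub_one_lt (pow_pos hp k)
    ⟨(p : K) ^ k, by rw [norm_pow, S.norm_p, inv_pow]⟩
    (lt_of_le_of_lt (by gcongr; linarith) I.radius_lt_one) (I.dilating.mono hsub) I.norm_lt_rho
    (inv_pos.2 (pow_pos hp (k + 3))) (inv_lt_one_of_one_lt₀ (one_lt_pow₀ (by linarith) (by omega)))
  have hrad : ‖c‖ / p ^ (k + 3) ≤ ((p : ℝ) ^ 2)⁻¹ / p ^ k := by
    rw [div_le_div_iff₀ (by positivity) (by positivity)]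
    calc ‖c‖ * p ^ k ≤ p * p ^ k := by gcongr
      _ = ((p : ℝ) ^ 2)⁻¹ * p ^ (k + 3) := by field_simp; ring
  have hrad1 : ‖c‖ / p ^ (k + 3) < 1 := by
    refine lt_of_le_of_lt ?_ I.radius_lt_one
    gcongr
    · linarith
    · omega
  have hsub' : closedBall b (‖c‖ / p ^ (k + 3)) ⊆ closedBall a (‖e (m + 1)‖ / p ^ k) := by
    rw [IsUltrametricDist.closedBall_eq_of_mem hb]
    refine closedBall_subset_closedBall (hrad.trans ?_)
    gcongr
    exact ((inv_sq_lt_rho p).trans heρ).le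
  have hb1' : ‖b - 1‖ < 1 :=
    norm_sub_one_lt_of_mem I.norm_sub_one_lt I.radius_lt_one (hsub hb)
  have hD := I.dilating.mono (hsub'.trans hsub)
  obtain ⟨hann', hiso⟩ := S.norm_orbitPt_sub_of_annulus hb1' (one_le_pow₀ (by linarith))
    (by rwa [← le_div_iff₀ (by positivity)]) hrad1 hmk' hD.norm_sub hb1 hann
  obtain ⟨b', hball, hb'1, hD', hρ, hnear⟩ := S.exists_isDilating_center hh hc1 hcp hcr hb1' hrad1
    ⟨(hpoly (m + 1) le_rfl).1.mono hsub', fun lam hlam => (hpoly (m + 1) le_rfl).2 lam (hsub' hlam),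
      by simpa using hiso⟩ hbη
  refine ⟨m, le_max_left _ _, b', ⟨hD', hb'1, hrad1, hρ⟩, ?_, hmk, fun lam hlam =>
    ⟨hann' lam (hball ▸ hlam), hnear lam hlam⟩⟩
  rw [hball]
  exact hsub'.trans hsub

/-- Choose `x` with `f_a(x)` so close to `h(a)` that the orbit stays near `1` for `k` more steps.
Then `p|x|^p = 1`, which makes `λ ↦ f_λ(x)` an isometry, and those steps dilate it by `p^k`. -/
lemma exists_isRoundStart [IsAlgClosed K] (S : IsSmallPerturbation p r q G)
    (hh : IsFixedPointFamily p G h) (hc1 : 1 < ‖c‖) (hcp : ‖c‖ < p) (hcr : ‖c‖ ≤ r)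
    (ha : ‖a - 1‖ < 1) {ε : ℝ} (hε : 0 < ε) :
    ∃ x n k b, IsRoundStart p G r c x n k b ∧
      closedBall b (‖c‖ / p ^ k) ⊆ closedBall a ε := by
  have hp := cast_pos' p
  have h2 := two_le_cast p
  obtain ⟨k, hk⟩ : ∃ k : ℕ, ‖c‖ / (p : ℝ) ^ k < min ε 1 := by
    obtain ⟨k, hk⟩ := exists_pow_lt_of_lt_one
      (show 0 < min ε 1 / ‖c‖ by positivity) (inv_lt_one (p := p))
    refine ⟨k, ?_⟩
    rwa [inv_pow, lt_div_iff₀ (by linarith), inv_mul_eq_div] at hk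
  have hkε := hk.trans_le (min_le_left _ _)
  have hk1 := hk.trans_le (min_le_right _ _)
  obtain ⟨e, he0, he⟩ := S.exists_radii c
  have he1 := norm_lt_one_of_radii (p := p) (by rwa [he0]) he 0
  have heρ := rho_lt_norm_of_radii (p := p) (by rwa [he0]) he 1
  have hha : ‖h a‖ = 1 := norm_eq_one_of_norm_sub_one_lt (S.norm_fixedPoint_sub_one hh ha)
  have hpoly : IsPolyLimit (closedBall 0 ‖e 1‖) fun z => perturb p G a z - h a := by
    have hid := IsPolyLimit.id (0 : K) ‖e 1‖
    refine ((((IsPolyLimit.const _).mul (hid.pow p)).add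
      ((IsPolyLimit.const _).mul (hid.pow (p + 1)))).add (S.polyLimit.mono ?_)).sub (.const _)
    exact closedBall_subset_closedBall (he1.le.trans S.one_lt.le)
  have hn0 : ‖perturb p G a 0 - h a‖ = 1 := by
    have h1 : ‖perturb p G a 0‖ < 1 :=
      (S.norm_perturb_le_rho ha (by simpa using (rho_pos p).le)).trans_lt (rho_lt_one p)
    rw [sub_eq_add_neg, norm_add_eq_of_lt, norm_neg, hha]
    rwa [norm_neg, hha]
  have hne : ‖perturb p G a (e 1) - h a‖ = ‖c‖ := by
    have h1 := S.norm_perturb_of_rho_lt ha heρ he1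
    rw [he 0, he0] at h1
    rw [← neg_add_eq_sub, norm_add_eq_of_lt, h1]
    rwa [norm_neg, hha, h1]
  -- The norm of `f_a(z) - h(a)` is `1` at `0` and `|c| > 1` at `e 1`.
  obtain ⟨x, hx, hxη⟩ := hpoly.exists_norm_lt (x := 0) (y := e 1) (by simp) (by simp)
    (by rw [hn0, hne]; exact hc1.ne) (show 0 < ((p : ℝ) ^ k)⁻¹ by positivity)
  have hx1 : ‖x‖ < 1 := by
    rw [mem_closedBall_zero_iff] at hx; exact hx.trans_lt he1
  have hfx : ‖perturb p G a x‖ = 1 := by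
    rw [← hha]
    refine norm_eq_of_norm_sub_lt (hxη.trans_le ?_)
    rw [hha]
    exact inv_le_one_of_one_le₀ (one_le_pow₀ (by linarith))
  have hpx : p * ‖x‖ ^ p = 1 := by
    have h1 := S.norm_perturb_le ha hx1
    rw [hfx, le_max_iff] at h1
    have h3 : 1 ≤ p * ‖x‖ ^ p := h1.resolve_left (by linarith [S.lt_one])
    rw [← hfx, S.norm_perturb ha hx1 (S.lt_one.trans_le h3)]
  have hr : ∀ lam ∈ closedBall a (‖c‖ / p ^ k), ‖perturb p G lam x‖ ≤ r := fun lam hlam => by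
    refine (S.norm_perturb_le (norm_sub_one_lt_of_mem ha hk1 hlam) hx1).trans ?_
    rw [hpx]
    exact max_le (S.lt_one.trans S.one_lt).le S.one_lt.le
  obtain ⟨b, hball, hb1, hD, hρ, -⟩ := S.exists_isDilating_center (x := x) (n := 1) hh hc1 hcp hcr
    ha hk1 ⟨S.polyLimit_perturb (.const x) fun _ _ => (hx1.trans S.one_lt).le, hr,
      fun lam _ mu _ => by
        rw [one_mul, ← mul_one ‖lam - mu‖, ← hpx]
        exact S.norm_perturb_sub_param hx1⟩ hxη
  exact ⟨x, _, k, b, ⟨hD, hb1, hk1, hρ⟩, hball ▸ closedBall_subset_closedBall hkε.le⟩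

end IsSmallPerturbation

/-! ### Infinitely many rounds. -/

/-- From time `n i` on, the orbit of `x` spends `m i + 1` steps in the annulus `ρ < |z| < 1` and
then `M i` steps in the disc `|z - 1| < 1`, with net contraction. -/
structure HasRounds (p : ℕ) [Fact p.Prime] {K : Type*} [NontriviallyNormedField K]
    (f : K → K) (x : K) (n m M : ℕ → ℕ) : Prop where
  next : ∀ i, n (i + 1) = n i + (m i + 1) + M i
  le : ∀ i, i ≤ m i
  pos : ∀ i, 0 < M i
  contraction : ∀ i, kappa p ^ m i * p ^ M i ≤ 1
  annulus : ∀ i, ∀ j < m i + 1, rho p < ‖f^[n i + j] x‖ ∧ ‖f^[n i + j] x‖ < 1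
  near_one : ∀ i, ∀ j < M i, ‖f^[n i + (m i + 1) + j] x - 1‖ < 1

lemma IsSmallPerturbation.exists_hasRounds {p : ℕ} [Fact p.Prime] {K : Type*}
    [NontriviallyNormedField K] [IsUltrametricDist K] [IsAlgClosed K] [CompleteSpace K]
    {r q : ℝ} {G h : K → K} {a c : K} (S : IsSmallPerturbation p r q G)
    (hh : IsFixedPointFamily p G h) (hc1 : 1 < ‖c‖) (hcp : ‖c‖ < p) (hcr : ‖c‖ ≤ r)
    (ha : ‖a - 1‖ < 1) {ε : ℝ} (hε : 0 < ε) :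
    ∃ lam ∈ closedBall a ε, ∃ x n m M, HasRounds p (perturb p G lam) x n m M := by
  have hp := cast_pos' p
  obtain ⟨x, n₀, k₀, b₀, I₀, hsub₀⟩ := S.exists_isRoundStart hh hc1 hcp hcr ha hε
  have hstep : ∀ i n b, IsRoundStart p G r c x n (k₀ + 3 * i) b → ∃ m ≥ i, ∃ b',
      IsRoundStart p G r c x (n + (m + 1) + (k₀ + 3 * i + 3)) (k₀ + 3 * (i + 1)) b' ∧ _ :=
    fun i n b I => S.exists_round hh hc1 hcp hcr I i
  choose! fm hm fb hI hsub hcon hrounds using hstep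
  -- The state is the starting time of round `i` and the center of its parameter disc. Discs are
  -- nested with radii `|c|/p^{k₀+3i}` tending to `0`, so the centers converge by completeness.
  let s : ℕ → ℕ × K := fun i => Nat.rec (n₀, b₀)
    (fun i s => (s.1 + (fm i s.1 s.2 + 1) + (k₀ + 3 * i + 3), fb i s.1 s.2)) i
  have hIs : ∀ i, IsRoundStart p G r c x (s i).1 (k₀ + 3 * i) (s i).2 := fun i => by
    induction i with
    | zero => exact I₀
    | succ i ih => exact hI i _ _ ih
  let B : ℕ → Set K := fun i => closedBall (s i).2 (‖c‖ / p ^ (k₀ + 3 * i))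
  have hanti : Antitone B := antitone_nat_of_succ_le fun i => hsub i _ _ (hIs i)
  have hmem : ∀ i j, i ≤ j → (s j).2 ∈ B i := fun i j hij =>
    hanti hij (mem_closedBall_self (by positivity))
  have hlim : Tendsto (fun i : ℕ => ‖c‖ / (p : ℝ) ^ (k₀ + 3 * i)) atTop (𝓝 0) := by
    have h1 : Tendsto (fun i : ℕ => ‖c‖ * ((p : ℝ)⁻¹) ^ (k₀ + 3 * i)) atTop (𝓝 (‖c‖ * 0)) := by
      refine Tendsto.const_mul _ ((tendsto_pow_atTop_nhds_zero_of_lt_one (by positivity)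
        IsSmallPerturbation.inv_lt_one).comp ?_)
      exact tendsto_atTop_mono (fun i => by omega : ∀ i : ℕ, i ≤ k₀ + 3 * i) tendsto_id
    simpa [div_eq_mul_inv] using h1
  have hcau : CauchySeq fun i => (s i).2 :=
    cauchySeq_of_le_tendsto_0' _ (fun i j hij => by
      have := hmem i j hij
      rwa [mem_closedBall'] at this) hlim
  obtain ⟨lam, hlam⟩ := cauchySeq_tendsto_of_complete hcau
  have hlamB : ∀ i, lam ∈ B i := fun i =>
    isClosed_closedBall.mem_of_tendsto hlam (eventually_atTop.2 ⟨i, fun j hj => hmem i j hj⟩)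
  refine ⟨lam, hsub₀ (hlamB 0), x, fun i => (s i).1, fun i => fm i (s i).1 (s i).2,
    fun i => k₀ + 3 * i + 3, fun i => rfl, fun i => hm i _ _ (hIs i), fun i => by omega,
    fun i => hcon i _ _ (hIs i), fun i => (hrounds i _ _ (hIs i) lam (hlamB (i + 1))).1,
    fun i => (hrounds i _ _ (hIs i) lam (hlamB (i + 1))).2⟩

/-! ### Itineraries, wandering and convergence. -/

section Itinerary

variable {K : Type*} [NontriviallyNormedField K] [IsUltrametricDist K]

lemma norm_lt_one_iff_of_norm_sub_lt_one {z w : K} (h : ‖z - w‖ < 1) : ‖z‖ < 1 ↔ ‖w‖ < 1 :=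
  ⟨fun hz => by simpa using norm_sub_lt_of_lt hz h, fun hw => by
    simpa using norm_add_lt_of_lt h hw⟩

/-- The orbit of the disc of center `y` and radius `d` shadows that of `y`, in the closed unit
ball, and the itinerary of `y` with respect to `{|z| < 1}` is not eventually periodic. -/
structure IsAperiodicDisc (f : K → K) (y : K) (d : ℝ) : Prop where
  norm_sub_lt : ∀ z ∈ closedBall y d, ∀ l, ‖f^[l] z - f^[l] y‖ < 1
  norm_le : ∀ l, ‖f^[l] y‖ ≤ 1
  aperiodic : ∀ N k, 0 < k → ¬ ∀ l ≥ N, (‖f^[l] y‖ < 1 ↔ ‖f^[l + k] y‖ < 1)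

namespace IsAperiodicDisc

variable {f : K → K} {y z w : K} {d : ℝ}

lemma norm_iterate_le (A : IsAperiodicDisc f y d) (hz : z ∈ closedBall y d) (l : ℕ) :
    ‖f^[l] z‖ ≤ 1 := by
  simpa using norm_add_le_of_le (A.norm_sub_lt z hz l).le (A.norm_le l)

lemma norm_iterate_lt_iff (A : IsAperiodicDisc f y d) (hz : z ∈ closedBall y d) (l : ℕ) :
    ‖f^[l] z‖ < 1 ↔ ‖f^[l] y‖ < 1 :=
  norm_lt_one_iff_of_norm_sub_lt_one (A.norm_sub_lt z hz l)

/-- A coincidence would give the itinerary of `y` the period `m - n` from time `n` on, as `z` and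
`w` both share that itinerary. -/
lemma not_lt_of_iterate_eq (A : IsAperiodicDisc f y d) (hz : z ∈ closedBall y d)
    (hw : w ∈ closedBall y d) {n m : ℕ} (h : f^[n] z = f^[m] w) : ¬ n < m := by
  intro hlt
  refine A.aperiodic n (m - n) (by omega) fun l hl => ?_
  rw [← A.norm_iterate_lt_iff hz l, ← A.norm_iterate_lt_iff hw,
    show l = (l - n) + n by omega, show l - n + n + (m - n) = (l - n) + m by omega,
    Function.iterate_add_apply, h, ← Function.iterate_add_apply]

lemma eq_of_iterate_eq (A : IsAperiodicDisc f y d) (hz : z ∈ closedBall y d)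
    (hw : w ∈ closedBall y d) {n m : ℕ} (h : f^[n] z = f^[m] w) : n = m :=
  le_antisymm (not_lt.1 (A.not_lt_of_iterate_eq hw hz h.symm))
    (not_lt.1 (A.not_lt_of_iterate_eq hz hw h))

/-- Convergence of every `k`-th iterate makes `f^{kn}(z)` and `f^{kn+k}(z)` closer than `L^{-k}`
eventually. They stay closer than `1` over the next `k` steps, so the itinerary would have eventual
period `k`. -/
lemma not_tendsto_iterate (A : IsAperiodicDisc f y d) {L : ℝ} (hL : 1 ≤ L)
    (hlip : ∀ z w, ‖z‖ ≤ 1 → ‖w‖ ≤ 1 → ‖f z - f w‖ ≤ L * ‖z - w‖)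
    (hz : z ∈ closedBall y d) {k : ℕ} (hk : 0 < k) (w : K) :
    ¬ Tendsto (fun n => f^[k * n] z) atTop (𝓝 w) := by
  intro hlim
  have hL0 : 0 < L := by linarith
  obtain ⟨N, hN⟩ := eventually_atTop.1 (hlim.eventually (ball_mem_nhds w
    (show 0 < (L ^ k)⁻¹ by positivity)))
  have hclose : ∀ n ≥ N, ∀ j ≤ k,
      ‖f^[k * n + j] z - f^[k * n + j + k] z‖ ≤ L ^ j * ‖f^[k * n] z - f^[k * n + k] z‖ := by
    intro n hn j
    induction j with
    | zero => simp
    | succ j ih =>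
      intro hj
      rw [← add_assoc, add_right_comm _ 1 k, Function.iterate_succ_apply',
        Function.iterate_succ_apply', pow_succ', mul_assoc]
      refine (hlip _ _ (A.norm_iterate_le hz _) (A.norm_iterate_le hz _)).trans ?_
      gcongr
      exact ih (by omega)
  refine A.aperiodic (k * N) k hk fun l hl => ?_
  rw [← A.norm_iterate_lt_iff hz, ← A.norm_iterate_lt_iff hz]
  refine norm_lt_one_iff_of_norm_sub_lt_one ?_
  have hn : N ≤ l / k := (Nat.le_div_iff_mul_le hk).2 (by rwa [mul_comm])
  have h1 := hN _ hn
  have h2 := hN (l / k + 1) (by omega)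
  simp only [dist_eq_norm] at h1 h2
  have h3 : ‖f^[k * (l / k)] z - f^[k * (l / k) + k] z‖ < (L ^ k)⁻¹ := by
    simpa [mul_add] using norm_sub_lt_of_lt h1 h2
  have h4 := hclose _ hn (l % k) (Nat.mod_lt _ hk).le
  rw [Nat.div_add_mod] at h4
  refine h4.trans_lt ?_
  calc L ^ (l % k) * ‖f^[k * (l / k)] z - f^[k * (l / k) + k] z‖
      ≤ L ^ k * ‖f^[k * (l / k)] z - f^[k * (l / k) + k] z‖ := by
        gcongr
        exact (Nat.mod_lt _ hk).le
    _ < L ^ k * (L ^ k)⁻¹ := by gcongr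
    _ = 1 := mul_inv_cancel₀ (by positivity)

end IsAperiodicDisc

end Itinerary

/-! ### A disc that shadows an orbit making rounds. -/

namespace HasRounds

variable {p : ℕ} [Fact p.Prime] {K : Type*} [NontriviallyNormedField K]
  {r q : ℝ} {G : K → K} {lam x : K} {n m M : ℕ → ℕ}

lemma le_start {f : K → K} (H : HasRounds p f x n m M) (i : ℕ) : n 0 + i ≤ n i := by
  induction i with
  | zero => exact le_rfl
  | succ i ih => rw [H.next]; omega

variable [IsUltrametricDist K]

/-- The annulus shrinks the distance by `κ^m` (its last step only does not expand), and the steps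
near `1` enlarge it at most by `p^M`; the product is at most `1`. -/
lemma norm_sub_le_of_round (S : IsSmallPerturbation p r q G) (hl : ‖lam - 1‖ < 1)
    (H : HasRounds p (perturb p G lam) x n m M) (i : ℕ) {z : K}
    (hz : ‖z - (perturb p G lam)^[n i] x‖ ≤ ((p : ℝ) ^ 2)⁻¹) (j : ℕ)
    (hj : j ≤ m i + 1 + M i) :
    ‖(perturb p G lam)^[j] z - (perturb p G lam)^[n i + j] x‖ ≤ ((p : ℝ) ^ 2)⁻¹ := by
  set f := perturb p G lam with hf
  have hp := cast_pos' p
  have h2 := two_le_cast p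
  have hk0 := kappa_pos p
  have hk1 := kappa_lt_one p
  have hd1 := inv_sq_lt_one p
  have hd0 := inv_sq_pos p
  have hrec : ∀ j < m i + 1, p * ‖f^[n i + j] x‖ ^ p = ‖f^[n i + (j + 1)] x‖ := fun j hj => by
    rw [← add_assoc, Function.iterate_succ_apply',
      S.norm_perturb_of_rho_lt hl (H.annulus i j hj).1 (H.annulus i j hj).2]
  have hone : ‖f^[n i + (m i + 1)] x‖ = 1 :=
    norm_eq_one_of_norm_sub_one_lt (H.near_one i 0 (H.pos i))
  have hpow : ∀ j, kappa p ^ j * ((p : ℝ) ^ 2)⁻¹ ≤ ((p : ℝ) ^ 2)⁻¹ := fun j =>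
    mul_le_of_le_one_left hd0.le (pow_le_one₀ hk0.le hk1.le)
  have hfst : ∀ j ≤ m i, ‖f^[j] z - f^[n i + j] x‖ ≤ kappa p ^ j * ((p : ℝ) ^ 2)⁻¹ := by
    intro j
    induction j with
    | zero => intro _; simpa using hz
    | succ j ih =>
      intro hj
      have hle : ‖f^[n i + (j + 1)] x‖ ≤ kappa p := by
        refine le_kappa_of_mul_pow_le_one ?_
        rw [hrec _ (by omega)]
        rcases hj.lt_or_eq with hj' | hj'
        · exact (H.annulus i _ (by omega)).2.le
        · rw [hj', hone]
      rw [← hrec j (by omega)] at hle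
      have h1 := S.norm_perturb_sub_le_max hl (H.annulus i j (by omega)).2 (hle.trans hk1.le)
        ((ih (by omega)).trans (hpow j))
      rw [max_eq_left hle] at h1
      rw [← add_assoc, Function.iterate_succ_apply', Function.iterate_succ_apply', pow_succ',
        mul_assoc]
      exact h1.trans (by gcongr; exact ih (by omega))
  have hmid : ‖f^[m i + 1] z - f^[n i + (m i + 1)] x‖ ≤ kappa p ^ m i * ((p : ℝ) ^ 2)⁻¹ := by
    have hlast := hrec (m i) (by omega)
    rw [hone] at hlast
    have h1 := S.norm_perturb_sub_le_max hl (H.annulus i (m i) (by omega)).2 hlast.le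
      ((hfst _ le_rfl).trans (hpow _))
    rw [hlast, max_eq_right hk1.le, one_mul] at h1
    rw [← add_assoc, Function.iterate_succ_apply', Function.iterate_succ_apply']
    exact h1.trans (hfst _ le_rfl)
  have hsnd : ∀ j ≤ M i, ‖f^[m i + 1 + j] z - f^[n i + (m i + 1) + j] x‖ ≤
      p ^ j * (kappa p ^ m i * ((p : ℝ) ^ 2)⁻¹) := by
    intro j
    induction j with
    | zero => intro _; simpa using hmid
    | succ j ih =>
      intro hj
      rw [← add_assoc, ← add_assoc _ j 1, Function.iterate_succ_apply',
        Function.iterate_succ_apply', pow_succ', mul_assoc]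
      have hx := norm_eq_one_of_norm_sub_one_lt (H.near_one i j (by omega))
      have hle := ih (by omega)
      have hle1 : (p : ℝ) ^ j * (kappa p ^ m i * ((p : ℝ) ^ 2)⁻¹) ≤ 1 := by
        refine le_trans ?_ (mul_le_one₀ (H.contraction i) hd0.le hd1.le)
        rw [← mul_assoc, mul_comm (kappa p ^ m i)]
        gcongr
        · linarith
        · omega
      have hz1 : ‖f^[m i + 1 + j] z‖ ≤ 1 := by
        simpa using norm_add_le_of_le (hle.trans hle1) hx.le
      exact (S.norm_perturb_sub_le hl hz1 hx.le).trans (by gcongr)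
  rcases le_or_gt j (m i) with hjm | hjm
  · exact (hfst j hjm).trans (hpow j)
  · have h1 := hsnd (j - (m i + 1)) (by omega)
    rw [show m i + 1 + (j - (m i + 1)) = j by omega,
      show n i + (m i + 1) + (j - (m i + 1)) = n i + j by omega] at h1
    refine h1.trans ?_
    rw [← mul_assoc]
    refine mul_le_of_le_one_left hd0.le (le_trans ?_ (H.contraction i))
    rw [mul_comm]
    gcongr
    · linarith
    · omega

lemma norm_iterate_le_one {f : K → K} (H : HasRounds p f x n m M) (i l : ℕ) (h0 : n 0 ≤ l)
    (hl : l < n i) : ‖f^[l] x‖ ≤ 1 := by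
  induction i with
  | zero => omega
  | succ i ih =>
    rw [H.next] at hl
    rcases lt_or_ge l (n i) with h | h
    · exact ih h
    rcases lt_or_ge l (n i + (m i + 1)) with h' | h'
    · have := (H.annulus i (l - n i) (by omega)).2
      rw [show n i + (l - n i) = l by omega] at this
      exact this.le
    · have := H.near_one i (l - (n i + (m i + 1))) (by omega)
      rw [show n i + (m i + 1) + (l - (n i + (m i + 1))) = l by omega] at this
      exact (norm_eq_one_of_norm_sub_one_lt this).le

lemma isAperiodicDisc (S : IsSmallPerturbation p r q G) (hl : ‖lam - 1‖ < 1)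
    (H : HasRounds p (perturb p G lam) x n m M) :
    IsAperiodicDisc (perturb p G lam) ((perturb p G lam)^[n 0] x) ((p : ℝ) ^ 2)⁻¹ := by
  set f := perturb p G lam with hf
  have hshift : ∀ l, f^[l] (f^[n 0] x) = f^[n 0 + l] x := fun l => by
    rw [← Function.iterate_add_apply, add_comm]
  refine ⟨fun z hz l => ?_, fun l => ?_, fun N k hk hper => ?_⟩
  · rw [hshift]
    refine lt_of_le_of_lt ?_ (inv_sq_lt_one p)
    have key : ∀ i l, n 0 + l ≤ n i →
        ‖f^[l] z - f^[n 0 + l] x‖ ≤ ((p : ℝ) ^ 2)⁻¹ := by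
      intro i
      induction i with
      | zero =>
        intro l hl
        obtain rfl : l = 0 := by omega
        simpa [dist_eq_norm] using hz
      | succ i ih =>
        intro l hl'
        rcases le_or_gt (n 0 + l) (n i) with h | h
        · exact ih l h
        · have hle := H.le_start i
          have h1 := ih (n i - n 0) (by omega)
          rw [show n 0 + (n i - n 0) = n i by omega] at h1
          rw [H.next] at hl'
          have h2 := H.norm_sub_le_of_round S hl i h1 (n 0 + l - n i) (by omega)
          rwa [← hf, ← Function.iterate_add_apply,
            show n 0 + l - n i + (n i - n 0) = l by omega,
            show n i + (n 0 + l - n i) = n 0 + l by omega] at h2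
    exact key l l (H.le_start l)
  · rw [hshift]
    have := H.le_start (l + 1)
    exact H.norm_iterate_le_one (l + 1) _ (by omega) (by omega)
  · simp only [hshift] at hper
    -- Round `i` starts after time `N` and its stay in the annulus lasts more than `k` steps. Period
    -- `k` would then prolong this stay forever, but the orbit has norm `1` at time `n i + m i + 1`.
    set i := max N k
    have hi := H.le_start i
    have hmi := H.le i
    have hNi : N ≤ i := le_max_left _ _
    have hki : k ≤ i := le_max_right _ _
    have hall : ∀ j, ‖f^[n i + j] x‖ < 1 := by
      intro j
      induction j using Nat.strong_induction_on with
      | _ j ih =>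
        rcases lt_or_ge j k with hjk | hjk
        · exact (H.annulus i j (by omega)).2
        · have h1 := (hper (n i + (j - k) - n 0) (by omega)).1
          rw [show n 0 + (n i + (j - k) - n 0) = n i + (j - k) by omega,
            show n 0 + (n i + (j - k) - n 0 + k) = n i + j by omega] at h1
          exact h1 (ih _ (by omega))
    have h1 := hall (m i + 1 + 0)
    rw [← add_assoc, norm_eq_one_of_norm_sub_one_lt (H.near_one i 0 (H.pos i))] at h1
    exact lt_irrefl _ h1

end HasRounds

/-! ### Convergent power series as small perturbations. -/

section Series

variable {p : ℕ} [Fact p.Prime] {r : ℝ} {Q : PowerSeries ℂ_[p]}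

lemma coeff_mul_pow_le_gaussNorm (hQ : PowerSeries.IsRestricted r Q) (n : ℕ) :
    ‖PowerSeries.coeff n Q‖ * r ^ n ≤ PowerSeries.gaussNorm (fun c : ℂ_[p] => ‖c‖) r Q :=
  PowerSeries.le_gaussNorm _ r Q ((PowerSeries.isRestricted_iff' r Q).1 hQ).bddAbove_range n

lemma norm_coeff_mul_pow_le (n : ℕ) {z : ℂ_[p]} (hz : ‖z‖ ≤ r) :
    ‖PowerSeries.coeff n Q * z ^ n‖ ≤ ‖PowerSeries.coeff n Q‖ * r ^ n := by
  rw [norm_mul, norm_pow]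
  gcongr

lemma summable_coeff_mul_pow (hQ : PowerSeries.IsRestricted r Q) {z : ℂ_[p]}
    (hz : ‖z‖ ≤ r) : Summable fun n => PowerSeries.coeff n Q * z ^ n := by
  refine NonarchimedeanAddGroup.summable_of_tendsto_cofinite_zero ?_
  rw [Nat.cofinite_eq_atTop]
  exact squeeze_zero_norm (fun n => norm_coeff_mul_pow_le n hz)
    ((PowerSeries.isRestricted_iff' r Q).1 hQ)

lemma norm_padicComplex_p : ‖(p : ℂ_[p])‖ = (p : ℝ)⁻¹ := by
  have h := PadicComplex.norm_extends p (p : PadicAlgCl p)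
  rw [PadicComplex.coe_natCast] at h
  rw [h, ← map_natCast (algebraMap ℚ_[p] (PadicAlgCl p)), PadicAlgCl.norm_extends, Padic.norm_p]

lemma isSmallPerturbation_evalSeries (hr : 1 < r) (hQ : PowerSeries.IsRestricted r Q)
    (hQnorm : PowerSeries.gaussNorm (fun c : ℂ_[p] => ‖c‖) r Q < rho p) :
    IsSmallPerturbation p r (PowerSeries.gaussNorm (fun c : ℂ_[p] => ‖c‖) r Q) (evalSeries Q) := by
  have hq0 : 0 ≤ PowerSeries.gaussNorm (fun c : ℂ_[p] => ‖c‖) r Q :=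
    PowerSeries.gaussNorm_nonneg _ r Q fun _ => norm_nonneg _
  have hbd : ∀ z : ℂ_[p], ‖z‖ ≤ r →
      ‖evalSeries Q z‖ ≤ PowerSeries.gaussNorm (fun c : ℂ_[p] => ‖c‖) r Q := fun z hz =>
    IsUltrametricDist.norm_tsum_le_of_forall_le_of_nonneg hq0 fun n =>
      (norm_coeff_mul_pow_le n hz).trans (coeff_mul_pow_le_gaussNorm hQ n)
  refine ⟨norm_padicComplex_p, hr, hq0, hQnorm, hbd, fun z w hz hw => ?_,
    ⟨_, fun z hz => hbd z (by simpa using hz)⟩, fun η hη => ?_⟩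
  · rw [evalSeries, evalSeries,
      ← (summable_coeff_mul_pow hQ hz).tsum_sub (summable_coeff_mul_pow hQ hw)]
    refine IsUltrametricDist.norm_tsum_le_of_forall_le_of_nonneg (by positivity) fun n => ?_
    cases n with
    | zero => simpa using by positivity
    | succ n =>
      rw [← mul_sub, norm_mul]
      calc ‖PowerSeries.coeff (n + 1) Q‖ * ‖z ^ (n + 1) - w ^ (n + 1)‖
          ≤ ‖PowerSeries.coeff (n + 1) Q‖ * (r ^ (n + 1) * ‖z - w‖) := by
            gcongr
            -- Since `r > 1`, `r^n ≤ r^(n+1)`, so the Gauss norm is also a Lipschitz constant.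
            refine (norm_pow_sub_pow_le_mul hz hw n).trans ?_
            gcongr
            · exact hr.le
            · omega
        _ ≤ _ := by
          rw [← mul_assoc]
          gcongr
          exact coeff_mul_pow_le_gaussNorm hQ (n + 1)
  · obtain ⟨N, hN⟩ := eventually_atTop.1
      (((PowerSeries.isRestricted_iff' r Q).1 hQ).eventually (eventually_le_nhds hη))
    refine ⟨PowerSeries.trunc N Q, fun z hz => ?_⟩
    have hz' : ‖z‖ ≤ r := by simpa using hz
    rw [evalSeries, ← (summable_coeff_mul_pow hQ hz').sum_add_tsum_nat_add N,
      ← Polynomial.eval₂_id, PowerSeries.eval₂_trunc_eq_sum_range]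
    simp only [RingHom.id_apply, add_sub_cancel_left]
    exact IsUltrametricDist.norm_tsum_le_of_forall_le_of_nonneg hη.le fun n =>
      (norm_coeff_mul_pow_le _ hz').trans (hN _ (by omega))

lemma differentiableAt_evalSeries (hQ : PowerSeries.IsRestricted r Q) {z : ℂ_[p]}
    (hz : ‖z‖ < r) : DifferentiableAt ℂ_[p] (evalSeries Q) z := by
  have hr0 : 0 ≤ r := (norm_nonneg z).trans hz.le
  set P := FormalMultilinearSeries.ofScalars ℂ_[p] fun n => PowerSeries.coeff n Q
  have hsum : P.sum = evalSeries Q := by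
    funext w
    exact (FormalMultilinearSeries.ofScalars_sum_eq _ w).trans (by simp [evalSeries])
  have hrad : ENNReal.ofReal r ≤ P.radius :=
    P.le_radius_of_bound _ fun n => by
      rw [FormalMultilinearSeries.ofScalars_norm, Real.coe_toNNReal r hr0]
      exact coeff_mul_pow_le_gaussNorm hQ n
  have hlt : ENNReal.ofReal ‖z‖ < P.radius :=
    ((ENNReal.ofReal_lt_ofReal_iff_of_nonneg (norm_nonneg z)).2 hz).trans_le hrad
  have hP := P.hasFPowerSeriesOnBall (pos_of_gt hlt)
  rw [hsum] at hP
  refine (hP.analyticAt_of_mem ?_).differentiableAt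
  simpa [edist_dist] using hlt

end Series

/-! ### Derivatives, conjugation by a translation, and the choice of `c`. -/

lemma norm_deriv_eq_of_dilating {K : Type*} [NontriviallyNormedField K] {f : K → K} {z : K}
    {C δ : ℝ} (hδ : 0 < δ) (hf : DifferentiableAt K f z)
    (h : ∀ w, ‖w - z‖ < δ → ‖f w - f z‖ = C * ‖w - z‖) : ‖deriv f z‖ = C := by
  have h1 := (hasDerivAt_iff_tendsto_slope.1 hf.hasDerivAt).norm
  refine tendsto_nhds_unique h1 (tendsto_const_nhds.congr' ?_)
  filter_upwards [self_mem_nhdsWithin, mem_nhdsWithin_of_mem_nhds (ball_mem_nhds z hδ)] with w hne hw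
  rw [mem_ball, dist_eq_norm] at hw
  have hpos : ‖w - z‖ ≠ 0 := norm_ne_zero_iff.2 (sub_ne_zero.2 hne)
  rw [slope_def_field, norm_div, h w hw]
  field_simp

lemma isRepellingFixedPoint_translate {K : Type*} [NontriviallyNormedField K] {f : K → K}
    {z v : K} (h : IsRepellingFixedPoint f (z + v)) :
    IsRepellingFixedPoint (fun w => f (w + v) - v) z := by
  refine ⟨by simp [h.1], ?_⟩
  rw [deriv_sub_const, deriv_comp_add_const]
  exact h.2

lemma iterate_translate {K : Type*} [AddGroup K] (f : K → K) (v z : K) (n : ℕ) :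
    (fun w => f (w + v) - v)^[n] z = f^[n] (z + v) - v := by
  induction n with
  | zero => simp
  | succ n ih => rw [Function.iterate_succ_apply', ih, Function.iterate_succ_apply',
      sub_add_cancel]

/-- An aperiodic disc of `f` yields a wandering disc, not attracted to an attracting cycle, of the
conjugate of `f` by a small translation. -/
lemma IsAperiodicDisc.wandering_translate {K : Type*} [NontriviallyNormedField K]
    [IsUltrametricDist K] {f : K → K} {y v c : K} {r L : ℝ} (hr : 1 < r)
    (A : IsAperiodicDisc f y ‖c‖) (hv : ‖v‖ < 1) (hc : c ≠ 0) (hL : 1 ≤ L)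
    (hlip : ∀ z w, ‖z‖ ≤ 1 → ‖w‖ ≤ 1 → ‖f z - f w‖ ≤ L * ‖z - w‖) :
    ∃ D : Set K, IsDisc D ∧ D ⊆ filledJulia (fun w => f (w + v) - v) (closedBall 0 r) ∧
      IsWanderingSet (fun w => f (w + v) - v) (closedBall 0 r) D ∧
      ∀ z ∈ D, ¬ IsAttractedToAttractingCycle (fun w => f (w + v) - v) (closedBall 0 r) z := by
  have hmem : ∀ z ∈ closedBall (y - v) ‖c‖, z + v ∈ closedBall y ‖c‖ := fun z hz => by
    rw [mem_closedBall, dist_eq_norm] at hz ⊢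
    rwa [sub_sub_eq_add_sub] at hz
  have hjulia : closedBall (y - v) ‖c‖ ⊆
      filledJulia (fun w => f (w + v) - v) (closedBall 0 r) := fun z hz n => by
    rw [iterate_translate, mem_closedBall_zero_iff]
    exact (norm_sub_le_of_le (A.norm_iterate_le (hmem z hz) n) hv.le).trans hr.le
  refine ⟨closedBall (y - v) ‖c‖, ⟨y - v, c, hc, Or.inr rfl⟩, hjulia,
    ⟨fun z hz => hjulia hz 0, ?_⟩, ?_⟩
  · rintro n m ⟨_, ⟨z, hz, rfl⟩, w, hw, hzw⟩
    rw [iterate_translate, iterate_translate, sub_left_inj] at hzw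
    exact (A.eq_of_iterate_eq (hmem w hw) (hmem z hz) hzw).symm
  · rintro z hz ⟨k, w, ⟨hk, -⟩, hlim⟩
    simp only [iterate_translate] at hlim
    refine A.not_tendsto_iterate hL hlip (hmem z hz) hk (w + v) ?_
    simpa using hlim.add_const v

lemma exists_norm_between {p : ℕ} [Fact p.Prime] {K : Type*} [NontriviallyNormedField K]
    [IsAlgClosed K] (hp : ‖(p : K)‖ = (p : ℝ)⁻¹) {r : ℝ} (hr : 1 < r) :
    ∃ c : K, 1 < ‖c‖ ∧ ‖c‖ < p ∧ ‖c‖ ≤ r := by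
  have h2 := two_le_cast p
  obtain ⟨N, hN⟩ := pow_unbounded_of_one_lt (p : ℝ) (lt_min hr (by linarith : (1 : ℝ) < p))
  have hN0 : 0 < N := Nat.pos_of_ne_zero fun h => by
    rw [h, pow_zero] at hN; linarith
  -- An `N`-th root of `p⁻¹` has norm `p^{1/N}`, as close to `1` as desired for large `N`.
  obtain ⟨c, hc⟩ := IsAlgClosed.exists_pow_nat_eq (p : K)⁻¹ hN0
  have hcN : ‖c‖ ^ N = p := by rw [← norm_pow, hc, norm_inv, hp, inv_inv]
  have hlt : ‖c‖ < min r p := by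
    by_contra! hle
    have := pow_le_pow_left₀ (by positivity) hle N
    linarith
  refine ⟨c, ?_, hlt.trans_le (min_le_right _ _), (hlt.trans_le (min_le_left _ _)).le⟩
  by_contra! hle
  have := pow_le_one₀ (norm_nonneg c) hle (n := N)
  linarith

end WanderingDisc

end

theorem theorem3p3 (p : ℕ) [Fact p.Prime]
    (r : ℝ) (hr : 1 < r) (hrv : ∃ c : ℂ_[p], ‖c‖ = r)
    (Q : PowerSeries ℂ_[p]) (hQ : PowerSeries.IsRestricted r Q)
    (hQnorm : PowerSeries.gaussNorm (fun c : ℂ_[p] => ‖c‖) r Q < WanderingDisc.rho p) :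
    (∀ lam ∈ WanderingDisc.paramDisc p,
      (∃! z : ℂ_[p], WanderingDisc.IsFixedPointNearOne Q lam z) ∧
      WanderingDisc.IsRepellingFixedPoint (WanderingDisc.conjugatedMap Q lam) 1) ∧
    WanderingDisc.paramDisc p ⊆
      closure {lam : ℂ_[p] | lam ∈ WanderingDisc.paramDisc p ∧
        ∃ D : Set ℂ_[p], WanderingDisc.IsDisc D ∧
          D ⊆ WanderingDisc.filledJulia (WanderingDisc.conjugatedMap Q lam)
            (Metric.closedBall 0 r) ∧
          WanderingDisc.IsWanderingSet (WanderingDisc.conjugatedMap Q lam)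
            (Metric.closedBall 0 r) D ∧
          ∀ z ∈ D, ¬ WanderingDisc.IsAttractedToAttractingCycle
            (WanderingDisc.conjugatedMap Q lam) (Metric.closedBall 0 r) z} := by
  have S := WanderingDisc.isSmallPerturbation_evalSeries hr hQ hQnorm
  have hmap : ∀ lam, WanderingDisc.perturbedMap Q lam =
      WanderingDisc.perturb p (WanderingDisc.evalSeries Q) lam := fun lam => rfl
  have hex : ∀ lam : ℂ_[p], ‖lam - 1‖ < 1 →
      ∃! z : ℂ_[p], WanderingDisc.IsFixedPointNearOne Q lam z := fun lam hl =>
    S.existsUnique_fixedPoint hl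
  have hh : WanderingDisc.IsFixedPointFamily p (WanderingDisc.evalSeries Q)
      (WanderingDisc.fixedPointNearOne Q) := fun lam hl =>
    Classical.epsilon_spec (hex lam hl).exists
  have hconj : ∀ lam, WanderingDisc.conjugatedMap Q lam = fun w =>
      WanderingDisc.perturb p (WanderingDisc.evalSeries Q) lam
        (w + (WanderingDisc.fixedPointNearOne Q lam - 1)) -
          (WanderingDisc.fixedPointNearOne Q lam - 1) := fun lam => by
    funext w
    exact (Equiv.symm_apply_eq _).2 (sub_add_cancel _ _).symm
  refine ⟨fun lam hlam => ?_, fun lam hlam => Metric.mem_closure_iff.2 fun ε hε => ?_⟩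
  · rw [WanderingDisc.paramDisc, Metric.mem_ball, dist_eq_norm] at hlam
    refine ⟨hex lam hlam, ?_⟩
    have hnear := S.norm_fixedPoint_sub_one hh hlam
    rw [hconj]
    refine WanderingDisc.isRepellingFixedPoint_translate ?_
    rw [add_sub_cancel]
    refine ⟨(hh lam hlam).2, ?_⟩
    rw [WanderingDisc.norm_deriv_eq_of_dilating (C := p) one_pos]
    · linarith [WanderingDisc.two_le_cast p]
    · have hd := WanderingDisc.differentiableAt_evalSeries (z := WanderingDisc.fixedPointNearOne Q lam)
        hQ (by rw [WanderingDisc.norm_eq_one_of_norm_sub_one_lt hnear]; exact hr)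
      exact DifferentiableAt.add (by fun_prop) hd
    · exact fun w hw => S.norm_perturb_sub_of_near_one hlam
        (by simpa using WanderingDisc.norm_add_lt_of_lt hw hnear) hnear
  · rw [WanderingDisc.paramDisc, Metric.mem_ball, dist_eq_norm] at hlam
    obtain ⟨c, hc1, hcp, hcr⟩ := WanderingDisc.exists_norm_between S.norm_p hr
    obtain ⟨mu, hmu, x, n, m, M, H⟩ := S.exists_hasRounds hh hc1 hcp hcr hlam
      (show 0 < min (ε / 2) (1 / 2) by positivity)
    have hmu1 : ‖mu - 1‖ < 1 := WanderingDisc.IsSmallPerturbation.norm_sub_one_lt_of_mem hlam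
      ((min_le_right _ _).trans_lt (by norm_num)) hmu
    refine ⟨mu, ⟨by rwa [WanderingDisc.paramDisc, Metric.mem_ball, dist_eq_norm], ?_⟩, ?_⟩
    · rw [hconj]
      have A := H.isAperiodicDisc S hmu1
      -- The radius `p⁻²` is the norm of `p²`, as the definition of a disc requires.
      have hp2 : ‖(p : ℂ_[p]) ^ 2‖ = ((p : ℝ) ^ 2)⁻¹ := by rw [norm_pow, S.norm_p, inv_pow]
      rw [← hp2] at A
      exact A.wandering_translate hr (S.norm_fixedPoint_sub_one hh hmu1)
        (pow_ne_zero 2 S.p_ne_zero) (by linarith [WanderingDisc.two_le_cast p])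
        fun z w hz hw => S.norm_perturb_sub_le hmu1 hz hw
    · rw [Metric.mem_closedBall'] at hmu
      exact hmu.trans_lt ((min_le_left _ _).trans_lt (half_lt_self hε))
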